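/- A $p\times q$ integer matrix $A$ is Monge if $A_{i,j}+A_{i+1,j+1}\le A_{i,j+1}+A_{i+1,j}$ for all $1\le i<p$, $1\le j<q$. Its core is the set of triples $(i,j,v)$ with $1\le i<p$, $1\le j<q$ and $v=A_{i,j+1}+A_{i+1,j}-A_{i,j}-A_{i+1,j+1}\neq 0$, and $\delta(A)$ is the number of these triples. The condensed representation of $A$ consists of $p$, $q$, the topmost row of $A$, the leftmost column of $A$, and a list of the elements of the core (each once, in any order). Two matrices $A,B$ of the same size with non-negative entries are $k$-equivalent if for all $i,j$ either $A_{i,j}=B_{i,j}$ or $\min\{A_{i,j},B_{i,j}\}>k$. Time is the number of elementary operations of a random access machine on integers, with finitely many variables and finitely many arrays with indirect addressing, whose operations are reading, writing, addition, subtraction and comparison at unit cost, and Boolean and loop control. (a) There are an algorithm and absolute constants $c_1,c_2$ such that the following holds for all integers $N\ge 2$, $1\le p,q\le N$ and $k\ge 1$. Given $k$ and the condensed representation of a Monge matrix $C\in\mathbb{Z}_{\ge 0}^{p\times q}$, the algorithm halts after at most $c_1\,(\delta(C)+N)\log N$ operations and outputs the condensed representation of a Monge matrix $C'\in\mathbb{Z}_{\ge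 0}^{p\times q}$ such that $\delta(C')\le c_2\,N\sqrt{k}$ and $C'$ is $k$-equivalent to $C$. (b) There is an absolute constant $c$ such that for all positive integers $p,q,s$ and every set $P\subseteq\{1,\dots,p\}\times\{1,\dots,q\}$ in which, for each $(i,j)\in P$, at most $s$ elements $(a,b)\in P\setminus\{(i,j)\}$ satisfy $a\ge i$ and $b\le j$, we have $|P|\le c\sqrt{pqs}$. -/

import Mathlib

/-! ## Monge matrices, cores and `k`-equivalence

Rows and columns are numbered from `0`, so the topmost row and the leftmost column have index `0`. -/

namespace Monge

/-- The density matrix, of size `(p - 1) × (q - 1)`: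
`A i (j+1) + A (i+1) j - A i j - A (i+1) (j+1)`. -/
def density {p q : ℕ} (A : Matrix (Fin p) (Fin q) ℤ) : Matrix (Fin (p - 1)) (Fin (q - 1)) ℤ :=
  fun i j =>
    A ⟨i, by omega⟩ ⟨j + 1, by omega⟩ + A ⟨i + 1, by omega⟩ ⟨j, by omega⟩
      - A ⟨i, by omega⟩ ⟨j, by omega⟩ - A ⟨i + 1, by omega⟩ ⟨j + 1, by omega⟩

/-- Monge matrices: `A i j + A (i+1) (j+1) ≤ A i (j+1) + A (i+1) j` for all adjacent rows and
columns. -/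
def IsMonge {p q : ℕ} (A : Matrix (Fin p) (Fin q) ℤ) : Prop :=
  ∀ (i : Fin (p - 1)) (j : Fin (q - 1)),
    A ⟨i, by omega⟩ ⟨j, by omega⟩ + A ⟨i + 1, by omega⟩ ⟨j + 1, by omega⟩
      ≤ A ⟨i, by omega⟩ ⟨j + 1, by omega⟩ + A ⟨i + 1, by omega⟩ ⟨j, by omega⟩

/-- The core: the set of triples `(i, j, v)` where `v` is the nonzero density entry at `(i, j)`. -/
def core {p q : ℕ} (A : Matrix (Fin p) (Fin q) ℤ) : Finset (Fin (p - 1) × Fin (q - 1) × ℤ) :=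
  (Finset.univ.filter fun x : Fin (p - 1) × Fin (q - 1) => density A x.1 x.2 ≠ 0).image
    fun x => (x.1, x.2, density A x.1 x.2)

/-- The size `δ(A)` of the core. -/
def coreSize {p q : ℕ} (A : Matrix (Fin p) (Fin q) ℤ) : ℕ := (core A).card

/-- `k`-equivalence of matrices: at each position the two entries are equal, or both exceed `k`. -/
def KEquiv {p q : ℕ} (k : ℤ) (A B : Matrix (Fin p) (Fin q) ℤ) : Prop :=
  ∀ i j, A i j = B i j ∨ k < min (A i j) (B i j)

end Monge

/-! ## Random access machine with step count

A program uses finitely many integer variables and finitely many integer arrays with indirect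
addressing.  The only arithmetic is addition and subtraction, and every elementary operation
(reading a constant or variable, array access, addition, subtraction, comparison, Boolean
connective, assignment) costs one unit. -/

namespace RAM

structure State where
  reg : ℕ → ℤ
  mem : ℕ → ℤ → ℤ

inductive Exp : Type
  | const (n : ℤ)
  | var (x : ℕ)
  /-- the cell of array `a` whose index is the value of `e` -/
  | load (a : ℕ) (e : Exp)
  | add (e₁ e₂ : Exp)
  | sub (e₁ e₂ : Exp)

def Exp.eval (s : State) : Exp → ℤ
  | .const n => n
  | .var x => s.reg x
  | .load a e => s.mem a (e.eval s)
  | .add e₁ e₂ => e₁.eval s + e₂.eval s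
  | .sub e₁ e₂ => e₁.eval s - e₂.eval s

def Exp.cost : Exp → ℕ
  | .const _ => 1
  | .var _ => 1
  | .load _ e => e.cost + 1
  | .add e₁ e₂ => e₁.cost + e₂.cost + 1
  | .sub e₁ e₂ => e₁.cost + e₂.cost + 1

inductive Test : Type
  | lt (e₁ e₂ : Exp)
  | eq (e₁ e₂ : Exp)
  | not (b : Test)
  | and (b₁ b₂ : Test)

def Test.eval (s : State) : Test → Prop
  | .lt e₁ e₂ => e₁.eval s < e₂.eval s
  | .eq e₁ e₂ => e₁.eval s = e₂.eval s
  | .not b => ¬ b.eval s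
  | .and b₁ b₂ => b₁.eval s ∧ b₂.eval s

def Test.cost : Test → ℕ
  | .lt e₁ e₂ => e₁.cost + e₂.cost + 1
  | .eq e₁ e₂ => e₁.cost + e₂.cost + 1
  | .not b => b.cost + 1
  | .and b₁ b₂ => b₁.cost + b₂.cost + 1

inductive Prog : Type
  | skip
  /-- `x := e` -/
  | assign (x : ℕ) (e : Exp)
  /-- `a[i] := e` -/
  | store (a : ℕ) (i e : Exp)
  | seq (c₁ c₂ : Prog)
  | ite (b : Test) (c₁ c₂ : Prog)
  | loop (b : Test) (c : Prog)

def State.setReg (s : State) (x : ℕ) (v : ℤ) : State :=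
  { s with reg := Function.update s.reg x v }

def State.setMem (s : State) (a : ℕ) (i v : ℤ) : State :=
  { s with mem := Function.update s.mem a (Function.update (s.mem a) i v) }

/-- `Exec c s t s'`: the (deterministic) run of the program `c` from the state `s` halts in the
state `s'` after `t` elementary operations.  `loop b c` is the loop "while `b` do `c`". -/
inductive Exec : Prog → State → ℕ → State → Prop
  | skip (s : State) : Exec .skip s 1 s
  | assign (s : State) (x : ℕ) (e : Exp) :
      Exec (.assign x e) s (e.cost + 1) (s.setReg x (e.eval s))
  | store (s : State) (a : ℕ) (i e : Exp) :
      Exec (.store a i e) s (i.cost + e.cost + 1) (s.setMem a (i.eval s) (e.eval s))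
  | seq {c₁ c₂ : Prog} {s s₁ s₂ : State} {t₁ t₂ : ℕ} :
      Exec c₁ s t₁ s₁ → Exec c₂ s₁ t₂ s₂ → Exec (.seq c₁ c₂) s (t₁ + t₂) s₂
  | ite_true {b : Test} {c₁ c₂ : Prog} {s s' : State} {t : ℕ} :
      b.eval s → Exec c₁ s t s' → Exec (.ite b c₁ c₂) s (b.cost + t + 1) s'
  | ite_false {b : Test} {c₁ c₂ : Prog} {s s' : State} {t : ℕ} :
      ¬ b.eval s → Exec c₂ s t s' → Exec (.ite b c₁ c₂) s (b.cost + t + 1) s'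
  | loop_true {b : Test} {c : Prog} {s s₁ s₂ : State} {t₁ t₂ : ℕ} :
      b.eval s → Exec c s t₁ s₁ → Exec (.loop b c) s₁ t₂ s₂ →
        Exec (.loop b c) s (b.cost + t₁ + t₂ + 1) s₂
  | loop_false {b : Test} {c : Prog} {s : State} :
      ¬ b.eval s → Exec (.loop b c) s (b.cost + 1) s

/-- The state `s` stores the condensed representation of `A`: variables `0` and `1` hold the
dimensions `p` and `q`, array `0` the topmost row, array `1` the leftmost column, variable `3` the
size of the core, and arrays `2`, `3`, `4` the rows, columns and values of the core elements, each
listed once, in some order. -/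
def StoresCondensed (s : State) {p q : ℕ} (A : Matrix (Fin p) (Fin q) ℤ) : Prop :=
  s.reg 0 = p ∧ s.reg 1 = q ∧
  (∀ (i : Fin p) (j : Fin q), (i : ℕ) = 0 → s.mem 0 (j : ℕ) = A i j) ∧
  (∀ (i : Fin p) (j : Fin q), (j : ℕ) = 0 → s.mem 1 (i : ℕ) = A i j) ∧
  s.reg 3 = Monge.coreSize A ∧
  ∃ e : Fin (Monge.coreSize A) ≃ {x // x ∈ Monge.core A}, ∀ m : Fin (Monge.coreSize A),
    s.mem 2 (m : ℕ) = ((e m).1.1 : ℕ) ∧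
    s.mem 3 (m : ℕ) = ((e m).1.2.1 : ℕ) ∧
    s.mem 4 (m : ℕ) = (e m).1.2.2

end RAM

/-!
Call an entry of the Monge matrix `C` small if it is at most `k`, and let `D ≥ 0` be its density.
The sum of `D` over a rectangle is the sum of its upper right and lower left corner entries minus
the two other corner entries, so it is at most `2k` if the former are small.

*Which core elements are needed.* An entry may be changed if all entries to its lower left,
including itself, exceed `k`; in row `a` these are the entries in the columns `b < L a`, where `L`
is nondecreasing (`Monge.Leftmost`). `Monge.shrink` first adds `B · #{a' ≤ a | b < L a'}` to the
entry `(a, b)`. This affects only the entries that may be changed, and it creates density in at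
most one cell per row, namely in `(i, L (i + 1) - 1)`. Then every cell whose lower left entry may
be changed loses its density `v`: this amounts to subtracting `v` from all entries to the lower
left of the cell. As `B` exceeds the total density by `k + 1`, all changed entries stay above `k`.
Doing the same for the transpose takes care of the upper right side. A core element that survives
both steps, and is not among the at most `p + q` new ones, has a small entry both to its lower
left and to its upper right, so the rectangle spanned by any two of these core elements carries at
most `2k` of them.

*Counting.* Cut the grid into blocks. On an antidiagonal of blocks, the points outside the two
extreme nonempty blocks all lie between a point of one and a point of the other
(`Monge.card_le_of_blocks`). Blocks with about `s` cells, arranged in a square grid, give the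
bound `O(√(pqs))` of `Monge.card_le_sqrt`, which serves both parts of the theorem.

*Time.* `L` is found by sweeping the rows from bottom to top with a pointer that moves only to the
left. It moves as long as the current row has a small entry to the left of it. The minimum of
these entries can be read off the root of a binary tree over the differences of adjacent columns,
whose nodes store sums and minimal prefix sums (`RAM.Tree`). Filling the tree changes each leaf
once and once more per core element; in the sweep, every core element and every move of the
pointer changes one leaf. Each change costs `O(log N)` (`RAM.run_treeAdd`), and there are `O(δ +
N)` of them (`RAM.run_sweep`). Everything else takes linear time. Programs are verified with a
predicate `RAM.Run` on final states and running times, with amortized costs in loops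
(`RAM.run_loop`).
-/

/-! ### Point sets with few points between any two -/

namespace Monge

open Finset in
/-- If between any two points of `P`, the second to the lower left of the first, there are at most
`s` points of `P`, then a block decomposition into blocks of size `r × w` bounds `P`: among the
blocks on one antidiagonal, all points outside the two extreme nonempty blocks lie between two
points of `P`. -/
theorem card_le_of_blocks {p q s r w : ℕ} (hr : 0 < r) (hw : 0 < w) (P : Finset (ℕ × ℕ))
    (hp : ∀ x ∈ P, x.1 < p ∧ x.2 < q)
    (hP : ∀ x ∈ P, ∀ y ∈ P,
      (P.filter fun z => x.1 ≤ z.1 ∧ z.1 ≤ y.1 ∧ y.2 ≤ z.2 ∧ z.2 ≤ x.2).card ≤ s) :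
    P.card ≤ (s + 2 * (r * w)) * (p / r + q / w + 1) := by
  have hmaps : ∀ x ∈ P, x.1 / r + x.2 / w ∈ range (p / r + q / w + 1) := by
    intro x hx
    have h1 := Nat.div_le_div_right (c := r) (hp x hx).1.le
    have h2 := Nat.div_le_div_right (c := w) (hp x hx).2.le
    simp only [mem_range]
    omega
  have hblock : ∀ I J : ℕ, (P.filter fun z => z.1 / r = I ∧ z.2 / w = J).card ≤ r * w := by
    intro I J
    have hsub : (P.filter fun z => z.1 / r = I ∧ z.2 / w = J) ⊆
        Ico (I * r) (I * r + r) ×ˢ Ico (J * w) (J * w + w) := by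
      intro z hz
      simp only [mem_filter] at hz
      simp only [mem_product, mem_Ico]
      have e1 := Nat.div_add_mod z.1 r
      have e2 := Nat.mod_lt z.1 hr
      have e3 := Nat.div_add_mod z.2 w
      have e4 := Nat.mod_lt z.2 hw
      rw [hz.2.1, mul_comm] at e1
      rw [hz.2.2, mul_comm] at e3
      omega
    refine (card_le_card hsub).trans ?_
    simp
  have h := card_le_mul_card_image_of_maps_to hmaps (s + 2 * (r * w)) ?_
  · simpa using h
  intro t _
  rcases (P.filter fun x => x.1 / r + x.2 / w = t).eq_empty_or_nonempty with he | hne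
  · rw [he]
    simp
  obtain ⟨x, hx, hxmin⟩ := exists_min_image _ (fun z => z.1 / r) hne
  obtain ⟨y, hy, hymax⟩ := exists_max_image _ (fun z => z.1 / r) hne
  rw [mem_filter] at hx hy
  have hcov : (P.filter fun x => x.1 / r + x.2 / w = t) ⊆
      (P.filter fun z => x.1 ≤ z.1 ∧ z.1 ≤ y.1 ∧ y.2 ≤ z.2 ∧ z.2 ≤ x.2) ∪
      ((P.filter fun z => z.1 / r = x.1 / r ∧ z.2 / w = x.2 / w) ∪
      (P.filter fun z => z.1 / r = y.1 / r ∧ z.2 / w = y.2 / w)) := by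
    intro z hz
    have h1 := hxmin z hz
    have h2 := hymax z hz
    rw [mem_filter] at hz
    simp only [mem_union, mem_filter, hz.1, true_and]
    by_cases hzx : z.1 / r = x.1 / r
    · exact Or.inr (Or.inl ⟨hzx, by omega⟩)
    by_cases hzy : z.1 / r = y.1 / r
    · exact Or.inr (Or.inr ⟨hzy, by omega⟩)
    left
    have lt_of : ∀ {a b c : ℕ}, a / c < b / c → a ≤ b := fun {a b c} h => by
      by_contra! h'
      exact absurd (Nat.div_le_div_right (c := c) h'.le) (by omega)
    exact ⟨lt_of (c := r) (by omega), lt_of (c := r) (by omega), lt_of (c := w) (by omega),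
      lt_of (c := w) (by omega)⟩
  have := (card_le_card hcov).trans (card_union_le _ _)
  have h3 := card_union_le (P.filter fun z => z.1 / r = x.1 / r ∧ z.2 / w = x.2 / w)
      (P.filter fun z => z.1 / r = y.1 / r ∧ z.2 / w = y.2 / w)
  have h4 := hP x hx.1 y hy.1
  have h5 := hblock (x.1 / r) (x.2 / w)
  have h6 := hblock (y.1 / r) (y.2 / w)
  omega

/-- Points in one row are pairwise comparable, so every row carries at most `s` points. -/
theorem card_le_rows {p q s : ℕ} (P : Finset (ℕ × ℕ))
    (hp : ∀ x ∈ P, x.1 < p ∧ x.2 < q)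
    (hP : ∀ x ∈ P, ∀ y ∈ P,
      (P.filter fun z => x.1 ≤ z.1 ∧ z.1 ≤ y.1 ∧ y.2 ≤ z.2 ∧ z.2 ≤ x.2).card ≤ s) :
    P.card ≤ s * p := by
  have h := Finset.card_le_mul_card_image_of_maps_to (s := P) (t := Finset.range p) (f := Prod.fst)
    (fun x hx => Finset.mem_range.2 (hp x hx).1) s ?_
  · simpa using h
  intro i _
  rcases (P.filter fun x => x.1 = i).eq_empty_or_nonempty with he | hne
  · simp [he]
  obtain ⟨x, hx, hxm⟩ := Finset.exists_max_image _ (fun z => z.2) hne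
  obtain ⟨y, hy, hym⟩ := Finset.exists_min_image _ (fun z => z.2) hne
  rw [Finset.mem_filter] at hx hy
  refine (Finset.card_le_card fun z hz => ?_).trans (hP x hx.1 y hy.1)
  have h1 := hxm z hz
  have h2 := hym z hz
  rw [Finset.mem_filter] at hz ⊢
  exact ⟨hz.1, by omega, by omega, h2, h1⟩

theorem card_le_cols {p q s : ℕ} (P : Finset (ℕ × ℕ))
    (hp : ∀ x ∈ P, x.1 < p ∧ x.2 < q)
    (hP : ∀ x ∈ P, ∀ y ∈ P,
      (P.filter fun z => x.1 ≤ z.1 ∧ z.1 ≤ y.1 ∧ y.2 ≤ z.2 ∧ z.2 ≤ x.2).card ≤ s) :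
    P.card ≤ s * q := by
  have h := Finset.card_le_mul_card_image_of_maps_to (s := P) (t := Finset.range q) (f := Prod.snd)
    (fun x hx => Finset.mem_range.2 (hp x hx).2) s ?_
  · simpa using h
  intro i _
  rcases (P.filter fun x => x.2 = i).eq_empty_or_nonempty with he | hne
  · simp [he]
  obtain ⟨x, hx, hxm⟩ := Finset.exists_min_image _ (fun z => z.1) hne
  obtain ⟨y, hy, hym⟩ := Finset.exists_max_image _ (fun z => z.1) hne
  rw [Finset.mem_filter] at hx hy
  refine (Finset.card_le_card fun z hz => ?_).trans (hP x hx.1 y hy.1)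
  have h1 := hxm z hz
  have h2 := hym z hz
  rw [Finset.mem_filter] at hz ⊢
  exact ⟨hz.1, h1, h2, by omega, by omega⟩

/-- If `ab / c ≥ 1`, rounding `√(ab / c)` down loses at most a factor of `2`. -/
theorem sqrt_div_le {a b c : ℕ} (hc : 0 < c) (h : c ≤ a * b) :
    (a : ℝ) * b ≤ 4 * (Nat.sqrt (a * b / c)) ^ 2 * c ∧ 0 < Nat.sqrt (a * b / c) := by
  have h1 : 0 < a * b / c := Nat.div_pos h hc
  have h2 : 0 < Nat.sqrt (a * b / c) := Nat.sqrt_pos.2 h1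
  have h3 := Nat.lt_succ_sqrt (a * b / c)
  have h4 : a * b < (a * b / c + 1) * c := by
    have := Nat.lt_div_mul_add (a := a * b) hc
    linarith [add_one_mul (a * b / c) c]
  refine ⟨?_, h2⟩
  set m := Nat.sqrt (a * b / c)
  have h5 : a * b / c + 1 ≤ 4 * m ^ 2 := by
    have : a * b / c + 1 ≤ (m + 1) * (m + 1) := h3
    nlinarith
  have h6 : a * b ≤ 4 * m ^ 2 * c := h4.le.trans (Nat.mul_le_mul_right _ h5)
  exact_mod_cast h6

/-- The sides of the blocks are about `√(ps/q)` and `√(qs/p)`, so that a block has at most `s` cells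
and the grid of blocks is about square. It has at most `5√(pq/s)` antidiagonals, with at most `3s`
points each. If a side would be less than `1`, or the number of blocks too small, a bound by rows,
columns, or the size of the grid is good enough. -/
theorem card_le_sqrt {p q s : ℕ} (hs : 0 < s) (P : Finset (ℕ × ℕ))
    (hp : ∀ x ∈ P, x.1 < p ∧ x.2 < q)
    (hP : ∀ x ∈ P, ∀ y ∈ P,
      (P.filter fun z => x.1 ≤ z.1 ∧ z.1 ≤ y.1 ∧ y.2 ≤ z.2 ∧ z.2 ≤ x.2).card ≤ s) :
    (P.card : ℝ) ≤ 15 * √((p : ℝ) * q * s) := by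
  have hx0 : (0 : ℝ) ≤ √((p : ℝ) * q * s) := Real.sqrt_nonneg _
  have small : ∀ m : ℕ, P.card ≤ m → (m : ℝ) * m ≤ p * q * s →
      (P.card : ℝ) ≤ 15 * √((p : ℝ) * q * s) := by
    intro m h1 h2
    have h3 : (m : ℝ) ≤ √((p : ℝ) * q * s) := Real.le_sqrt_of_sq_le (by rw [sq]; exact h2)
    have h4 : (P.card : ℝ) ≤ m := by exact_mod_cast h1
    linarith
  rcases P.eq_empty_or_nonempty with rfl | ⟨x₀, hx₀⟩
  · rw [Finset.card_empty, Nat.cast_zero]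
    positivity
  have hp0 : 0 < p := by have := hp x₀ hx₀; omega
  have hq0 : 0 < q := by have := hp x₀ hx₀; omega
  by_cases c1 : p * s < q
  · refine small (s * p) (card_le_rows P hp hP) ?_
    have : s * p * (s * p) ≤ p * q * s := by nlinarith [Nat.zero_le (p * s)]
    exact_mod_cast this
  by_cases c2 : q * s < p
  · refine small (s * q) (card_le_cols P hp hP) ?_
    have : s * q * (s * q) ≤ p * q * s := by nlinarith [Nat.zero_le (q * s)]
    exact_mod_cast this
  by_cases c3 : p * q < s
  · refine small (p * q) ?_ ?_
    · have hsub : P ⊆ Finset.range p ×ˢ Finset.range q := fun x hx => by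
        simpa using hp x hx
      simpa using Finset.card_le_card hsub
    · have : p * q * (p * q) ≤ p * q * s := Nat.mul_le_mul_left _ c3.le
      exact_mod_cast this
  push Not at c1 c2 c3
  obtain ⟨r1, r0⟩ := sqrt_div_le (a := p) (b := s) hq0 c1
  obtain ⟨w1, w0⟩ := sqrt_div_le (a := q) (b := s) hp0 c2
  have r2 : Nat.sqrt (p * s / q) ^ 2 * q ≤ p * s :=
    (Nat.mul_le_mul_right _ (Nat.sqrt_le' _)).trans (Nat.div_mul_le_self _ _)
  have w2 : Nat.sqrt (q * s / p) ^ 2 * p ≤ q * s :=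
    (Nat.mul_le_mul_right _ (Nat.sqrt_le' _)).trans (Nat.div_mul_le_self _ _)
  set r := Nat.sqrt (p * s / q)
  set w := Nat.sqrt (q * s / p)
  have hmain := card_le_of_blocks r0 w0 P hp hP
  have hrw : r * w ≤ s := by
    have h1 : (r * w) ^ 2 * (p * q) ≤ s ^ 2 * (p * q) := by
      calc (r * w) ^ 2 * (p * q) = (r ^ 2 * q) * (w ^ 2 * p) := by ring
        _ ≤ (p * s) * (q * s) := Nat.mul_le_mul r2 w2
        _ = s ^ 2 * (p * q) := by ring
    exact (Nat.pow_le_pow_iff_left two_ne_zero).1 (Nat.le_of_mul_le_mul_right h1 (by positivity))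
  have hsR : (0 : ℝ) < s := by exact_mod_cast hs
  have hpR : (0 : ℝ) < p := by exact_mod_cast hp0
  have hqR : (0 : ℝ) < q := by exact_mod_cast hq0
  have hrR : (0 : ℝ) < r := by exact_mod_cast r0
  have hwR : (0 : ℝ) < w := by exact_mod_cast w0
  have aux : ∀ y : ℝ, 0 ≤ y → (y * s) ^ 2 ≤ 4 * (p * q * s) → y * s ≤ 2 * √((p : ℝ) * q * s) := by
    intro y _ h
    have : √(4 * ((p : ℝ) * q * s)) = 2 * √((p : ℝ) * q * s) := by
      rw [Real.sqrt_mul (by norm_num), show (4 : ℝ) = 2 ^ 2 by norm_num,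
        Real.sqrt_sq (by norm_num)]
    rw [← this]
    exact Real.le_sqrt_of_sq_le h
  have b1 : ((p / r : ℕ) : ℝ) * s ≤ 2 * √((p : ℝ) * q * s) := by
    refine (mul_le_mul_of_nonneg_right Nat.cast_div_le hsR.le).trans (aux _ (by positivity) ?_)
    rw [div_mul_eq_mul_div, div_pow, div_le_iff₀ (by positivity)]
    nlinarith [mul_le_mul_of_nonneg_left r1 (mul_pos hpR hsR).le]
  have b2 : ((q / w : ℕ) : ℝ) * s ≤ 2 * √((p : ℝ) * q * s) := by
    refine (mul_le_mul_of_nonneg_right Nat.cast_div_le hsR.le).trans (aux _ (by positivity) ?_)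
    rw [div_mul_eq_mul_div, div_pow, div_le_iff₀ (by positivity)]
    nlinarith [mul_le_mul_of_nonneg_left w1 (mul_pos hqR hsR).le]
  have b3 : (s : ℝ) ≤ √((p : ℝ) * q * s) := by
    refine Real.le_sqrt_of_sq_le ?_
    have : s ^ 2 ≤ p * q * s := by nlinarith
    exact_mod_cast this
  have hm2 : P.card ≤ 3 * s * (p / r + q / w + 1) :=
    hmain.trans (Nat.mul_le_mul_right _ (by omega))
  have hm3 : (P.card : ℝ) ≤ 3 * s * ((p / r : ℕ) + (q / w : ℕ) + 1) := by exact_mod_cast hm2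
  nlinarith

/-- The points between `x` and `y` lie to the lower left of `x` or are `x`, so there are at most
`s + 1 ≤ 2s` of them. -/
theorem card_le_of_lower_left {p q s : ℕ} (hs : 0 < s) (P : Finset (Fin p × Fin q))
    (hP : ∀ x ∈ P, (P.filter fun y => y ≠ x ∧ x.1 ≤ y.1 ∧ y.2 ≤ x.2).card ≤ s) :
    (P.card : ℝ) ≤ 30 * √((p : ℝ) * q * s) := by
  let f : Fin p × Fin q ↪ ℕ × ℕ := Fin.valEmbedding.prodMap Fin.valEmbedding
  have h := card_le_sqrt (p := p) (q := q) (s := 2 * s) (by omega) (P.map f) ?_ ?_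
  · rw [Finset.card_map] at h
    refine h.trans ?_
    have h1 : √((p : ℝ) * q * (2 * s : ℕ)) ≤ √(2 ^ 2 * ((p : ℝ) * q * s)) := by
      refine Real.sqrt_le_sqrt ?_
      push_cast
      have : (0 : ℝ) ≤ p * q * s := by positivity
      linarith
    rw [Real.sqrt_mul (x := (2 : ℝ) ^ 2) (by norm_num), Real.sqrt_sq (by norm_num)] at h1
    linarith
  · intro x hx
    obtain ⟨y, -, rfl⟩ := Finset.mem_map.1 hx
    exact ⟨y.1.2, y.2.2⟩
  · intro x hx y _
    obtain ⟨x, hx', rfl⟩ := Finset.mem_map.1 hx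
    have h1 := hP x hx'
    have hsub : ((P.map f).filter fun z => (f x).1 ≤ z.1 ∧ z.1 ≤ y.1 ∧ y.2 ≤ z.2 ∧ z.2 ≤ (f x).2) ⊆
        (insert x (P.filter fun y => y ≠ x ∧ x.1 ≤ y.1 ∧ y.2 ≤ x.2)).map f := by
      intro z hz
      rw [Finset.mem_filter] at hz
      obtain ⟨hz, h1, -, -, h2⟩ := hz
      obtain ⟨z, hz', rfl⟩ := Finset.mem_map.1 hz
      refine Finset.mem_map_of_mem _ ?_
      by_cases hzx : z = x
      · simp [hzx]
      · rw [Finset.mem_insert, Finset.mem_filter]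
        exact Or.inr ⟨hz', hzx, h1, h2⟩
    have h2 := Finset.card_le_card hsub
    rw [Finset.card_map] at h2
    have h3 := Finset.card_insert_le x (P.filter fun y => y ≠ x ∧ x.1 ≤ y.1 ∧ y.2 ≤ x.2)
    omega

end Monge

/-! ### Time-bounded runs of programs -/

namespace RAM

/-- The program `c`, started in `s`, halts after some number `t` of operations in some state `s'`
such that `Q t s'`. -/
def Run (c : Prog) (s : State) (Q : ℕ → State → Prop) : Prop :=
  ∃ t s', Exec c s t s' ∧ Q t s'

/-- Sequential execution of a list of programs. -/
def Prog.block : List Prog → Prog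
  | [] => .skip
  | c :: cs => .seq c (block cs)

/-- The variables a program may assign. -/
def Prog.regs : Prog → List ℕ
  | .skip => []
  | .assign x _ => [x]
  | .store _ _ _ => []
  | .seq c₁ c₂ => c₁.regs ++ c₂.regs
  | .ite _ c₁ c₂ => c₁.regs ++ c₂.regs
  | .loop _ c => c.regs

/-- The arrays a program may write to. -/
def Prog.arrs : Prog → List ℕ
  | .skip => []
  | .assign _ _ => []
  | .store a _ _ => [a]
  | .seq c₁ c₂ => c₁.arrs ++ c₂.arrs
  | .ite _ c₁ c₂ => c₁.arrs ++ c₂.arrs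
  | .loop _ c => c.arrs

/-- `s'` differs from `s` only in variables and arrays that `c` writes to. -/
def Frame (c : Prog) (s s' : State) : Prop :=
  (∀ x, x ∉ c.regs → s'.reg x = s.reg x) ∧ (∀ a, a ∉ c.arrs → s'.mem a = s.mem a)

theorem Exec.frame {c : Prog} {s s' : State} {t : ℕ} (h : Exec c s t s') : Frame c s s' := by
  unfold Frame
  induction h with
  | skip s => simp
  | assign s x e => simp +contextual [Prog.regs, State.setReg]
  | store s a i e => simp +contextual [Prog.arrs, State.setMem]
  | seq _ _ ih₁ ih₂ => simp +contextual [Prog.regs, Prog.arrs, ih₁, ih₂]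
  | ite_true _ _ ih => simp +contextual [Prog.regs, Prog.arrs, ih]
  | ite_false _ _ ih => simp +contextual [Prog.regs, Prog.arrs, ih]
  | loop_true _ _ _ ih₁ ih₂ =>
    simp only [Prog.regs, Prog.arrs] at *
    exact ⟨fun x hx => (ih₂.1 x hx).trans (ih₁.1 x hx), fun x hx => (ih₂.2 x hx).trans (ih₁.2 x hx)⟩
  | loop_false _ => simp

theorem Run.mono {c : Prog} {s : State} {Q Q' : ℕ → State → Prop} (h : Run c s Q)
    (hQ : ∀ t s', Frame c s s' → Q t s' → Q' t s') : Run c s Q' := by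
  obtain ⟨t, s', he, hq⟩ := h
  exact ⟨t, s', he, hQ t s' he.frame hq⟩

theorem run_skip {s : State} {Q : ℕ → State → Prop} : Run .skip s Q ↔ Q 1 s := by
  constructor
  · rintro ⟨t, s', h, hq⟩
    cases h
    exact hq
  · exact fun h => ⟨_, _, .skip s, h⟩

theorem run_assign {x : ℕ} {e : Exp} {s : State} {Q : ℕ → State → Prop} :
    Run (.assign x e) s Q ↔ Q (e.cost + 1) (s.setReg x (e.eval s)) := by
  constructor
  · rintro ⟨t, s', h, hq⟩
    cases h
    exact hq
  · exact fun h => ⟨_, _, .assign s x e, h⟩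

theorem run_store {a : ℕ} {i e : Exp} {s : State} {Q : ℕ → State → Prop} :
    Run (.store a i e) s Q ↔ Q (i.cost + e.cost + 1) (s.setMem a (i.eval s) (e.eval s)) := by
  constructor
  · rintro ⟨t, s', h, hq⟩
    cases h
    exact hq
  · exact fun h => ⟨_, _, .store s a i e, h⟩

theorem run_seq {c₁ c₂ : Prog} {s : State} {Q : ℕ → State → Prop} :
    Run (.seq c₁ c₂) s Q ↔
      Run c₁ s fun t₁ s₁ => Run c₂ s₁ fun t₂ s₂ => Q (t₁ + t₂) s₂ := by
  constructor
  · rintro ⟨t, s', h, hq⟩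
    cases h with
    | seq h₁ h₂ => exact ⟨_, _, h₁, _, _, h₂, hq⟩
  · rintro ⟨t₁, s₁, h₁, t₂, s₂, h₂, hq⟩
    exact ⟨_, _, .seq h₁ h₂, hq⟩

theorem run_ite {b : Test} {c₁ c₂ : Prog} {s : State} {Q : ℕ → State → Prop} :
    Run (.ite b c₁ c₂) s Q ↔
      (b.eval s → Run c₁ s fun t s' => Q (b.cost + t + 1) s') ∧
      (¬ b.eval s → Run c₂ s fun t s' => Q (b.cost + t + 1) s') := by
  constructor
  · rintro ⟨t, s', h, hq⟩
    cases h with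
    | ite_true hb h => exact ⟨fun _ => ⟨_, _, h, hq⟩, fun hn => absurd hb hn⟩
    | ite_false hb h => exact ⟨fun hn => absurd hn hb, fun _ => ⟨_, _, h, hq⟩⟩
  · rintro ⟨h₁, h₂⟩
    by_cases hb : b.eval s
    · obtain ⟨t, s', h, hq⟩ := h₁ hb
      exact ⟨_, _, .ite_true hb h, hq⟩
    · obtain ⟨t, s', h, hq⟩ := h₂ hb
      exact ⟨_, _, .ite_false hb h, hq⟩

theorem run_block_nil {s : State} {Q : ℕ → State → Prop} : Run (.block []) s Q ↔ Q 1 s :=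
  run_skip

theorem run_block_cons {c : Prog} {cs : List Prog} {s : State} {Q : ℕ → State → Prop} :
    Run (.block (c :: cs)) s Q ↔
      Run c s fun t₁ s₁ => Run (.block cs) s₁ fun t₂ s₂ => Q (t₁ + t₂) s₂ :=
  run_seq

/-- Loops with amortized running time: the invariant `I φ s` carries a potential `φ`, out of which
every iteration is paid. -/
theorem run_loop {b : Test} {c : Prog} (I : ℕ → State → Prop)
    (step : ∀ φ s, I φ s → b.eval s →
      Run c s fun t s' => ∃ φ', φ' + t + b.cost + 1 ≤ φ ∧ I φ' s')
    (φ : ℕ) (s : State) (h : I φ s) :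
    Run (.loop b c) s fun t s' =>
      ¬ b.eval s' ∧ ∃ φ', t + φ' ≤ φ + b.cost + 1 ∧ I φ' s' := by
  induction φ using Nat.strong_induction_on generalizing s with
  | _ φ ih =>
    by_cases hb : b.eval s
    · obtain ⟨t₁, s₁, he₁, φ', hφ, hI⟩ := step φ s h hb
      obtain ⟨t₂, s₂, he₂, hb₂, φ₂, ht, hq⟩ := ih φ' (by omega) s₁ hI
      exact ⟨_, _, .loop_true hb he₁ he₂, hb₂, φ₂, by omega, hq⟩
    · exact ⟨_, _, .loop_false hb, hb, φ, by omega, h⟩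

/-- Counting loop: `for x = l, …, y - 1 do c`. -/
def Prog.forUp (x : ℕ) (l : ℕ) (y : ℕ) (c : Prog) : Prog :=
  .seq (.assign x (.const l))
    (.loop (.lt (.var x) (.var y)) (.seq c (.assign x (.add (.var x) (.const 1)))))

theorem run_forUp {x y l n T : ℕ} {c : Prog} {s : State} (I : ℕ → State → Prop)
    (hxy : x ≠ y) (hx : x ∉ c.regs) (hy : y ∉ c.regs) (hln : l ≤ n) (hn : s.reg y = n)
    (h0 : I l (s.setReg x l))
    (step : ∀ (i : ℕ) (s : State), l ≤ i → i < n → s.reg x = i → s.reg y = n → I i s →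
      Run c s fun t s' => t ≤ T ∧ I (i + 1) (s'.setReg x (i + 1))) :
    Run (.forUp x l y c) s fun t s' => t ≤ 6 + n * (T + 8) ∧ I n s' := by
  have key := run_loop (b := .lt (.var x) (.var y))
    (c := .seq c (.assign x (.add (.var x) (.const 1))))
    (fun φ s => ∃ i : ℕ, l ≤ i ∧ i ≤ n ∧ s.reg x = i ∧ s.reg y = n ∧ I i s ∧ φ = (n - i) * (T + 8))
    (by
      rintro φ s ⟨i, hli, hin, hsx, hsy, hI, rfl⟩ hb
      have hlt : i < n := by simpa [Test.eval, Exp.eval, hsx, hsy] using hb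
      rw [run_seq]
      refine (step i s hli hlt hsx hsy hI).mono ?_
      rintro t s' hf ⟨ht, hI'⟩
      rw [run_assign]
      have hx' : s'.reg x = i := (hf.1 x hx).trans hsx
      have hy' : s'.reg y = n := (hf.1 y hy).trans hsy
      refine ⟨(n - (i + 1)) * (T + 8), ?_, i + 1, by omega, by omega, ?_, ?_, ?_, rfl⟩
      · obtain ⟨d, rfl⟩ : ∃ d, n = i + 1 + d := ⟨n - (i + 1), by omega⟩
        have h1 : i + 1 + d - i = d + 1 := by omega
        have h2 : i + 1 + d - (i + 1) = d := by omega
        rw [h1, h2, add_mul]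
        simp only [Exp.cost, Test.cost]
        omega
      · simp [State.setReg, Exp.eval, hx']
      · simp [State.setReg, hy', hxy.symm]
      · simpa [Exp.eval, hx'] using hI')
    ((n - l) * (T + 8)) (s.setReg x l)
    ⟨l, le_rfl, hln, by simp [State.setReg], by simp [State.setReg, hxy.symm, hn], h0, rfl⟩
  rw [Prog.forUp, run_seq, run_assign]
  refine key.mono ?_
  rintro t s' - ⟨hb, φ', ht, i, hli, hin, hsx, hsy, hI, -⟩
  have : i = n := by
    simp only [Test.eval, Exp.eval, hsx, hsy, Nat.cast_lt] at hb
    omega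
  subst this
  have h3 : (i - l) * (T + 8) ≤ i * (T + 8) := Nat.mul_le_mul_right _ (Nat.sub_le _ _)
  simp only [Test.cost, Exp.cost] at ht ⊢
  exact ⟨by omega, hI⟩

theorem reg_setReg (s : State) (x y : ℕ) (v : ℤ) :
    (s.setReg x v).reg y = if y = x then v else s.reg y := by
  simp [State.setReg, Function.update_apply]

theorem mem_setReg (s : State) (x : ℕ) (v : ℤ) : (s.setReg x v).mem = s.mem := rfl

theorem reg_setMem (s : State) (a : ℕ) (i v : ℤ) : (s.setMem a i v).reg = s.reg := rfl

theorem mem_setMem (s : State) (a b : ℕ) (i v j : ℤ) :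
    (s.setMem a i v).mem b j = if b = a then (if j = i then v else s.mem a j) else s.mem b j := by
  by_cases h : b = a
  · subst h
    simp [State.setMem, Function.update_apply]
  · simp [State.setMem, h]

/-! ### A tree of prefix minima -/

/-- Adds the value of variable `21` to the leaf whose number is in variable `20`, and recomputes
its ancestors.  Variable `10` holds the number of leaves; array `10` is the table `n ↦ ⌊n / 2⌋`
of parents. -/
def treeAdd : Prog :=
  .block [
    .assign 22 (.add (.var 10) (.var 20)),
    .store 11 (.var 22) (.add (.load 11 (.var 22)) (.var 21)),
    .store 12 (.var 22) (.load 11 (.var 22)),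
    .loop (.lt (.const 1) (.var 22)) (.block [
      .assign 22 (.load 10 (.var 22)),
      .store 11 (.var 22) (.add (.load 11 (.add (.var 22) (.var 22)))
        (.load 11 (.add (.add (.var 22) (.var 22)) (.const 1)))),
      .ite (.lt (.load 12 (.add (.var 22) (.var 22)))
          (.add (.load 11 (.add (.var 22) (.var 22)))
            (.load 12 (.add (.add (.var 22) (.var 22)) (.const 1)))))
        (.store 12 (.var 22) (.load 12 (.add (.var 22) (.var 22))))
        (.store 12 (.var 22) (.add (.load 11 (.add (.var 22) (.var 22)))
            (.load 12 (.add (.add (.var 22) (.var 22)) (.const 1)))))])]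

/-- At the inner node `n`, arrays `11` and `12` agree with the values at the two children. -/
def NodeOk (s : State) (n : ℕ) : Prop :=
  s.mem 11 n = s.mem 11 (n + n) + s.mem 11 (n + n + 1) ∧
  s.mem 12 n = min (s.mem 12 (n + n)) (s.mem 11 (n + n) + s.mem 12 (n + n + 1))

/-- The state stores the complete binary tree with leaves `d 0, …, d (2 ^ h - 1)`, in heap order
with root `1`.  Array `11` holds the sum over the leaves below a node, and array `12` the minimum
of the nonempty prefix sums over these leaves. -/
structure Tree (s : State) (h : ℕ) (d : ℕ → ℤ) : Prop where
  size : s.reg 10 = 2 ^ h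
  par : ∀ n : ℕ, n < 2 ^ (h + 1) → s.mem 10 n = (n / 2 : ℕ)
  leaf : ∀ b : ℕ, b < 2 ^ h → s.mem 11 (2 ^ h + b) = d b ∧ s.mem 12 (2 ^ h + b) = d b
  node : ∀ n : ℕ, 0 < n → n < 2 ^ h → NodeOk s n

theorem Tree.congr {s s' : State} {h : ℕ} {d : ℕ → ℤ} (ht : Tree s h d)
    (h0 : s'.reg 10 = s.reg 10) (h1 : s'.mem 10 = s.mem 10) (h2 : s'.mem 11 = s.mem 11)
    (h3 : s'.mem 12 = s.mem 12) : Tree s' h d := by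
  obtain ⟨a, b, c, e⟩ := ht
  exact ⟨h0 ▸ a, h1 ▸ b, by rw [h2, h3]; exact c, by unfold NodeOk at *; rw [h2, h3]; exact e⟩

theorem NodeOk.of_eq {s s' : State} {n : ℕ} (ho : NodeOk s n)
    (h : ∀ j : ℤ, j = n ∨ j = n + n ∨ j = n + n + 1 →
      s'.mem 11 j = s.mem 11 j ∧ s'.mem 12 j = s.mem 12 j) :
    NodeOk s' n := by
  unfold NodeOk at *
  rw [(h n (by simp)).1, (h n (by simp)).2, (h (n+n) (by simp)).1, (h (n+n) (by simp)).2,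
    (h (n+n+1) (by simp)).1, (h (n+n+1) (by simp)).2]
  exact ho

theorem run_treeAdd {s : State} {h b : ℕ} {d : ℕ → ℤ} {x : ℤ} (ht : Tree s h d) (hb : b < 2 ^ h)
    (h20 : s.reg 20 = b) (h21 : s.reg 21 = x) :
    Run treeAdd s fun t s' =>
      t ≤ 70 * (h + 1) ∧ Tree s' h (Function.update d b (d b + x)) := by
  obtain ⟨hs, hp, hl, hn⟩ := ht
  have hpow : 2 ^ (h + 1) = 2 * 2 ^ h := by ring
  have h2 := Nat.pos_of_ne_zero (pow_ne_zero h (two_ne_zero (α := ℕ)))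
  simp only [treeAdd, run_block_cons, run_assign, run_store, run_block_nil]
  have hcast : (2 ^ h + (b : ℤ)) = ((2 ^ h + b : ℕ) : ℤ) := by push_cast; rfl
  have hz2 : ((2 : ℤ) ^ h) = ((2 ^ h : ℕ) : ℤ) := by push_cast; rfl
  -- while the loop is at the node `n`, only the parent of `n` may disagree with its children
  refine (run_loop (I := fun φ s' => s'.reg 10 = 2 ^ h ∧ s'.mem 10 = s.mem 10 ∧
    (∀ c : ℕ, c < 2 ^ h → s'.mem 11 (2 ^ h + c) = Function.update d b (d b + x) c ∧
      s'.mem 12 (2 ^ h + c) = Function.update d b (d b + x) c) ∧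
    ∃ n : ℕ, s'.reg 22 = n ∧ 0 < n ∧ (∀ m : ℕ, 0 < m → m < 2 ^ h → m ≠ n / 2 → NodeOk s' m) ∧
      ∃ j ≤ h, n < 2 ^ (j + 1) ∧ φ = 60 * j) ?_ (60 * h) _ ?_).mono ?_
  · rintro φ s₁ ⟨g10, gm, gl, n, g22, hn0, gn, j, hj, hnj, rfl⟩ hc
    simp only [Test.eval, Exp.eval, g22] at hc
    have hn1 : 1 < n := by exact_mod_cast hc
    have hn2 : n < 2 ^ (h + 1) := hnj.trans_le (Nat.pow_le_pow_right (by norm_num) (by omega))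
    have hj0 : j ≠ 0 := by
      rintro rfl
      omega
    obtain ⟨i, rfl⟩ : ∃ i, j = i + 1 := ⟨j - 1, by omega⟩
    obtain ⟨m, hm⟩ : ∃ m, m = n / 2 := ⟨_, rfl⟩
    have hpar : s₁.mem 10 n = m := by rw [gm, hp n hn2, hm]
    have hmh : m < 2 ^ h := by omega
    have hm0 : 0 < m := by omega
    -- writing to the inner node `m` affects neither the leaves nor inner nodes other than
    -- `m` and its parent
    have fin : ∀ s₂ : State, s₂.reg 10 = 2 ^ h → s₂.reg 22 = m → s₂.mem 10 = s₁.mem 10 →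
        (∀ i : ℤ, i ≠ m → s₂.mem 11 i = s₁.mem 11 i ∧ s₂.mem 12 i = s₁.mem 12 i) →
        NodeOk s₂ m →
        (s₂.reg 10 = 2 ^ h ∧ s₂.mem 10 = s.mem 10 ∧
        (∀ c : ℕ, c < 2 ^ h → s₂.mem 11 (2 ^ h + c) = Function.update d b (d b + x) c ∧
          s₂.mem 12 (2 ^ h + c) = Function.update d b (d b + x) c) ∧
        ∃ n : ℕ, s₂.reg 22 = n ∧ 0 < n ∧
          (∀ m : ℕ, 0 < m → m < 2 ^ h → m ≠ n / 2 → NodeOk s₂ m) ∧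
          ∃ j ≤ h, n < 2 ^ (j + 1) ∧ 60 * i = 60 * j) := by
      intro s₂ k10 k22 km kne kok
      refine ⟨k10, km.trans gm, fun c hc => ?_, m, k22, hm0, fun m' hm'0 hm' hne => ?_, i,
        by omega, ?_, rfl⟩
      · rw [(kne _ (by rw [hz2]; norm_cast; omega)).1, (kne _ (by rw [hz2]; norm_cast; omega)).2]
        exact gl c hc
      · by_cases hmm : m' = m
        · exact hmm ▸ kok
        · exact (gn m' hm'0 hm' (by omega)).of_eq fun j hj => kne j (by omega)
      · have : 2 ^ (i + 1 + 1) = 2 * 2 ^ (i + 1) := by ring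
        omega
    simp only [run_block_cons, run_assign, run_store, run_block_nil, run_ite, Exp.cost, Test.cost]
    have e1 : ((m : ℤ) + m = m) ↔ False := iff_false_intro (by omega)
    have e2 : ((m : ℤ) + m + 1 = m) ↔ False := iff_false_intro (by omega)
    refine ⟨fun hlt => ⟨60 * i, by omega, fin _ ?_ ?_ ?_ ?_ ?_⟩,
      fun hlt => ⟨60 * i, by omega, fin _ ?_ ?_ ?_ ?_ ?_⟩⟩
    all_goals first
      | simpa [reg_setReg, reg_setMem] using g10
      | simpa [reg_setReg, reg_setMem, Exp.eval, g22] using hpar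
      | (ext z; simp [mem_setReg, mem_setMem])
      | (intro z hz
         simp [mem_setReg, mem_setMem, reg_setReg, reg_setMem, Exp.eval, g22, hpar, hz])
      | (simp [NodeOk, Test.eval, Exp.eval, mem_setReg, mem_setMem, reg_setReg, reg_setMem, g22,
          hpar, e1, e2] at hlt ⊢
         omega)
  · simp only [Exp.eval, reg_setReg, mem_setReg, reg_setMem, mem_setMem, hs, h20, h21]
    norm_num
    refine ⟨by ext z; simp [mem_setReg, mem_setMem], fun c hc => ?_, 2 ^ h + b, by push_cast; rfl,
      by omega, fun m hm0 hm hne => (hn m hm0 hm).of_eq fun j hj => ?_, by omega⟩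
    · by_cases hcb : c = b
      · subst hcb
        simp [hl c hc]
      · simp [hcb, hl c hc]
    · have : j ≠ 2 ^ h + (b : ℤ) := by rw [hz2]; omega
      simp [mem_setMem, mem_setReg, this]
  · rintro t s₁ hf ⟨hc, φ', ht, g10, gm, gl, n, g22, hn0, gn, -⟩
    simp only [Test.eval, Exp.eval, g22, Test.cost, Exp.cost] at hc ht ⊢
    have hn1 : n = 1 := by
      have : ¬ (1 < n) := by exact_mod_cast hc
      omega
    subst hn1
    exact ⟨by omega, g10, by rw [gm]; exact hp, gl, fun m h0 hm => gn m h0 hm (by omega)⟩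

/-- The root of the tree carries the minimum of the nonempty prefix sums of the leaves. -/
theorem Tree.root_le_iff {s : State} {h : ℕ} {d : ℕ → ℤ} (ht : Tree s h d) (x : ℤ) :
    s.mem 12 1 ≤ x ↔ ∃ b < 2 ^ h, ∑ j ∈ Finset.range (b + 1), d j ≤ x := by
  have key : ∀ t n : ℕ, 2 ^ h ≤ n * 2 ^ t → (n + 1) * 2 ^ t ≤ 2 ^ (h + 1) →
      s.mem 11 n = ∑ j ∈ Finset.range (2 ^ t), d (n * 2 ^ t - 2 ^ h + j) ∧
      ∀ x, s.mem 12 n ≤ x ↔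
        ∃ b < 2 ^ t, ∑ j ∈ Finset.range (b + 1), d (n * 2 ^ t - 2 ^ h + j) ≤ x := by
    intro t
    induction t with
    | zero =>
      intro n h1 h2
      have hpow : 2 ^ (h + 1) = 2 * 2 ^ h := by ring
      obtain ⟨b, rfl⟩ : ∃ b, n = 2 ^ h + b := ⟨n - 2 ^ h, by omega⟩
      obtain ⟨e1, e2⟩ := ht.leaf b (by omega)
      push_cast
      simp [e1, e2]
    | succ t ih =>
      intro n h1 h2
      have hpow : 2 ^ (h + 1) = 2 * 2 ^ h := by ring
      have ht2 : 2 ^ (t + 1) = 2 * 2 ^ t := by ring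
      have ht0 : 0 < 2 ^ t := by positivity
      have hmul : n * 2 ^ (t + 1) = (n + n) * 2 ^ t := by ring
      have hmul2 : (n + 1) * 2 ^ (t + 1) = (n + n + 1 + 1) * 2 ^ t := by ring
      have hm1 : (n + n + 1) * 2 ^ t = (n + n) * 2 ^ t + 2 ^ t := by ring
      have hm2 : (n + n + 1 + 1) * 2 ^ t = (n + n) * 2 ^ t + 2 ^ t + 2 ^ t := by ring
      have hn0 : 0 < n := by
        rcases Nat.eq_zero_or_pos n with rfl | h
        · have : 0 < 2 ^ h := by positivity
          omega
        · exact h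
      have hnh : n < 2 ^ h := by
        have : (n + 1) * 2 ≤ 2 ^ (h + 1) :=
          (Nat.mul_le_mul_left _ (by omega)).trans h2
        omega
      obtain ⟨l1, l2⟩ := ih (n + n) (by omega) (by omega)
      obtain ⟨r1, r2⟩ := ih (n + n + 1) (by omega) (by omega)
      obtain ⟨o1, o2⟩ := ht.node n hn0 hnh
      push_cast at l1 l2 r1 r2
      have hsh : ∀ j, (n + n + 1) * 2 ^ t - 2 ^ h + j = (n + n) * 2 ^ t - 2 ^ h + (2 ^ t + j) := by
        intro j
        omega
      simp only [hsh] at r1 r2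
      rw [hmul, ht2, two_mul]
      refine ⟨by rw [o1, l1, r1, Finset.sum_range_add], fun x => ?_⟩
      rw [o2, min_le_iff, l2, ← le_sub_iff_add_le', r2]
      constructor
      · rintro (⟨b, hb, hx⟩ | ⟨b, hb, hx⟩)
        · exact ⟨b, by omega, hx⟩
        · refine ⟨2 ^ t + b, by omega, ?_⟩
          rw [add_assoc, Finset.sum_range_add, ← l1]
          linarith
      · rintro ⟨b, hb, hx⟩
        by_cases hbt : b < 2 ^ t
        · exact Or.inl ⟨b, hbt, hx⟩
        · obtain ⟨c, rfl⟩ : ∃ c, b = 2 ^ t + c := ⟨b - 2 ^ t, by omega⟩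
          refine Or.inr ⟨c, by omega, ?_⟩
          rw [add_assoc, Finset.sum_range_add, ← l1] at hx
          linarith
  have := (key h 1 (by simp) (by ring_nf; rfl)).2 x
  simpa using this

end RAM

/-! ### Shrinking the core on one side -/

namespace Monge

/-- The density of a matrix whose entries are given by a function on all index pairs. -/
def dens (A : ℕ → ℕ → ℤ) (i j : ℕ) : ℤ := A i (j + 1) + A (i + 1) j - A i j - A (i + 1) (j + 1)

/-- The sequence `(r m, c m)`, `m < n`, lists each cell of nonzero density of the `p × q` matrix
`A` once. -/
structure IsCoreList (p q n : ℕ) (A : ℕ → ℕ → ℤ) (r c : ℕ → ℕ) : Prop where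
  mem : ∀ m < n, r m + 1 < p ∧ c m + 1 < q ∧ dens A (r m) (c m) ≠ 0
  inj : ∀ m < n, ∀ m' < n, r m = r m' → c m = c m' → m = m'
  surj : ∀ i j, i + 1 < p → j + 1 < q → dens A i j ≠ 0 → ∃ m < n, r m = i ∧ c m = j

/-- The cells of nonzero density of a `p × q` matrix. -/
def coreCells (p q : ℕ) (A : ℕ → ℕ → ℤ) : Finset (ℕ × ℕ) :=
  (Finset.range (p - 1) ×ˢ Finset.range (q - 1)).filter fun x => dens A x.1 x.2 ≠ 0

theorem mem_coreCells {p q : ℕ} {A : ℕ → ℕ → ℤ} {x : ℕ × ℕ} :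
    x ∈ coreCells p q A ↔ x.1 + 1 < p ∧ x.2 + 1 < q ∧ dens A x.1 x.2 ≠ 0 := by
  simp only [coreCells, Finset.mem_filter, Finset.mem_product, Finset.mem_range]
  omega

theorem IsCoreList.image_eq {p q n : ℕ} {A : ℕ → ℕ → ℤ} {r c : ℕ → ℕ}
    (h : IsCoreList p q n A r c) :
    (Finset.range n).image (fun m => (r m, c m)) = coreCells p q A := by
  ext ⟨i, j⟩
  simp only [Finset.mem_image, Finset.mem_range, mem_coreCells, Prod.mk.injEq]
  constructor
  · rintro ⟨m, hm, rfl, rfl⟩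
    exact h.mem m hm
  · rintro ⟨hi, hj, hd⟩
    exact h.surj i j hi hj hd

theorem IsCoreList.injOn {p q n : ℕ} {A : ℕ → ℕ → ℤ} {r c : ℕ → ℕ}
    (h : IsCoreList p q n A r c) :
    Set.InjOn (fun m => (r m, c m)) (Finset.range n : Set ℕ) := by
  intro m hm m' hm' he
  simp only [Finset.coe_range, Set.mem_Iio, Prod.mk.injEq] at hm hm' he
  exact h.inj m hm m' hm' he.1 he.2

theorem IsCoreList.card_eq {p q n : ℕ} {A : ℕ → ℕ → ℤ} {r c : ℕ → ℕ}
    (h : IsCoreList p q n A r c) : (coreCells p q A).card = n := by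
  rw [← h.image_eq, Finset.card_image_of_injOn h.injOn, Finset.card_range]

theorem IsCoreList.sum_eq {p q n : ℕ} {A : ℕ → ℕ → ℤ} {r c : ℕ → ℕ}
    (h : IsCoreList p q n A r c) (f : ℕ → ℕ → ℤ) (hf : ∀ i j, dens A i j = 0 → f i j = 0) :
    ∑ m ∈ Finset.range n, f (r m) (c m)
      = ∑ i ∈ Finset.range (p - 1), ∑ j ∈ Finset.range (q - 1), f i j := by
  rw [← Finset.sum_product', ← Finset.sum_image (f := fun x : ℕ × ℕ => f x.1 x.2) h.injOn,
    h.image_eq, coreCells, Finset.sum_filter_of_ne]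
  intro x _ hx hd
  exact hx (hf _ _ hd)

/-- Telescoping of the density over the rectangle with rows `a, …, a'` and columns `b, …, b'`. -/
theorem sum_dens (A : ℕ → ℕ → ℤ) {a a' b b' : ℕ} (ha : a ≤ a') (hb : b ≤ b') :
    ∑ i ∈ Finset.Ico a a', ∑ j ∈ Finset.Ico b b', dens A i j
      = A a b' + A a' b - A a b - A a' b' := by
  have row : ∀ i, ∑ j ∈ Finset.Ico b b', dens A i j =
      A i b' + A (i + 1) b - A i b - A (i + 1) b' := by
    intro i
    induction b', hb using Nat.le_induction with
    | base => simp
    | succ n hn ih =>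
      rw [Finset.sum_Ico_succ_top hn, ih, dens]
      ring
  simp only [row]
  induction a', ha using Nat.le_induction with
  | base => simp
  | succ n hn ih =>
    rw [Finset.sum_Ico_succ_top hn, ih]
    ring

/-- `L a` is the leftmost column in which some row `a' ≥ a` of the `p × q` matrix `A` has an entry
at most `k`, and `q` if there is none. So `b < L a` iff all entries to the lower left of `(a, b)`,
including this one, exceed `k`. -/
structure Leftmost (p q k : ℕ) (A : ℕ → ℕ → ℤ) (L : ℕ → ℕ) : Prop where
  le : ∀ a < p, L a ≤ q
  mono : ∀ a a', a ≤ a' → a' < p → L a ≤ L a'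
  lt : ∀ a < p, ∀ b < L a, k < A a b
  wit : ∀ a < p, ∀ b < q, L a ≤ b → ∃ a' b', a ≤ a' ∧ a' < p ∧ b' ≤ b ∧ A a' b' ≤ k

/-- The matrix `A`, changed on the entries `(a, b)` with `b < L a` only, so that the density is
removed from the cells whose lower left entry is of this kind.  Removing a density `v` amounts to
subtracting `v` from all entries to the lower left of the cell.  Before that, `B` is added
`#{a' ≤ a | b < L a'}` times; this creates density only in one cell per row and keeps the changed
entries large. -/
def shrink (q : ℕ) (A : ℕ → ℕ → ℤ) (L : ℕ → ℕ) (B : ℤ) (a b : ℕ) : ℤ :=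
  A a b + (∑ a' ∈ Finset.range (a + 1), if b < L a' then B else 0)
    - ∑ i ∈ Finset.range a, ∑ j ∈ Finset.Ico b (q - 1), if j < L (i + 1) then dens A i j else 0

theorem dens_shrink {q : ℕ} {A : ℕ → ℕ → ℤ} {L : ℕ → ℕ} {B : ℤ} {i j : ℕ} (hj : j + 1 < q) :
    dens (shrink q A L B) i j =
      (if j < L (i + 1) then 0 else dens A i j) + (if L (i + 1) = j + 1 then B else 0) := by
  have hj' : j < q - 1 := by omega
  unfold dens shrink
  simp only [Finset.sum_range_succ _ (i + 1), Finset.sum_range_succ _ i,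
    Finset.sum_eq_sum_Ico_succ_bot hj']
  rw [dens]
  split_ifs <;> omega

theorem shrink_eq {p q k : ℕ} {A : ℕ → ℕ → ℤ} {L : ℕ → ℕ} (B : ℤ) (hL : Leftmost p q k A L)
    {a b : ℕ} (ha : a < p) (hb : L a ≤ b) : shrink q A L B a b = A a b := by
  unfold shrink
  rw [Finset.sum_eq_zero, Finset.sum_eq_zero]
  · ring
  · intro i hi
    refine Finset.sum_eq_zero fun j hj => if_neg ?_
    rw [Finset.mem_range] at hi
    rw [Finset.mem_Ico] at hj
    have := hL.mono (i + 1) a (by omega) ha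
    omega
  · intro i hi
    refine if_neg ?_
    rw [Finset.mem_range] at hi
    have := hL.mono i a (by omega) ha
    omega

theorem lt_shrink {p q k : ℕ} {A : ℕ → ℕ → ℤ} {L : ℕ → ℕ} {B : ℤ}
    (hA : ∀ i j, i + 1 < p → j + 1 < q → 0 ≤ dens A i j)
    (hB : k + 1 + ∑ i ∈ Finset.range (p - 1), ∑ j ∈ Finset.range (q - 1), dens A i j ≤ B)
    {a b : ℕ} (ha : a < p) (hb : b < L a) (h0 : 0 ≤ A a b) : k < shrink q A L B a b := by
  have hD : ∀ i ∈ Finset.range (p - 1), ∀ j ∈ Finset.range (q - 1), 0 ≤ dens A i j := by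
    intro i hi j hj
    rw [Finset.mem_range] at hi hj
    exact hA i j (by omega) (by omega)
  have hB0 : 0 ≤ B := by
    have := Finset.sum_nonneg fun i hi => Finset.sum_nonneg (hD i hi)
    omega
  have h1 : B ≤ ∑ a' ∈ Finset.range (a + 1), if b < L a' then B else 0 := by
    refine le_trans (by simp [hb]) (Finset.single_le_sum (f := fun a' => if b < L a' then B else 0)
      (fun i _ => ?_) (Finset.self_mem_range_succ a))
    split_ifs <;> simp [hB0]
  have h2 : (∑ i ∈ Finset.range a, ∑ j ∈ Finset.Ico b (q - 1),
      if j < L (i + 1) then dens A i j else 0)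
      ≤ ∑ i ∈ Finset.range (p - 1), ∑ j ∈ Finset.range (q - 1), dens A i j := by
    refine (Finset.sum_le_sum (g := fun i => ∑ j ∈ Finset.range (q - 1), dens A i j)
      fun i hi => ?_).trans (Finset.sum_le_sum_of_subset_of_nonneg (fun i hi => ?_)
        fun i hi _ => Finset.sum_nonneg (hD i hi))
    · have hi' : i ∈ Finset.range (p - 1) := by
        rw [Finset.mem_range] at hi ⊢
        omega
      refine (Finset.sum_le_sum (g := fun j => dens A i j) fun j hj => ?_).trans
        (Finset.sum_le_sum_of_subset_of_nonneg (fun j hj => ?_) fun j hj _ => hD i hi' j hj)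
      · have := hD i hi' j (by rw [Finset.mem_range]; exact (Finset.mem_Ico.1 hj).2)
        split_ifs <;> simp [this]
      · rw [Finset.mem_range]
        exact (Finset.mem_Ico.1 hj).2
    · rw [Finset.mem_range] at hi ⊢
      omega
  unfold shrink
  omega

theorem shrink_left (q : ℕ) (A : ℕ → ℕ → ℤ) (L : ℕ → ℕ) (B : ℤ) (a : ℕ) :
    shrink q A L B a 0 = A a 0 + ((∑ a' ∈ Finset.range (a + 1), if 0 < L a' then B else 0)
      - ∑ i ∈ Finset.range a, ∑ j ∈ Finset.range (q - 1),
        if j < L (i + 1) then dens A i j else 0) := by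
  rw [shrink, Finset.range_eq_Ico]
  simp only [Finset.range_eq_Ico]
  ring

theorem shrink_top (q : ℕ) (A : ℕ → ℕ → ℤ) (L : ℕ → ℕ) (B : ℤ) (b : ℕ) :
    shrink q A L B 0 b = A 0 b + if b < L 0 then B else 0 := by
  simp [shrink]

theorem dens_transpose (A : ℕ → ℕ → ℤ) (i j : ℕ) :
    dens (fun a b => A b a) i j = dens A j i := by
  unfold dens
  ring

end Monge

/-! ### The tree of column differences -/

namespace RAM

open Monge

/-- The input of the program `shrinkProg`. The variables `0`, …, `3` and the arrays `0`, …, `4` hold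
the dimensions of the matrix `A`, the threshold `k`, and the condensed representation of `A`, the
core being listed in the order `(r 0, c 0), …, (r (n - 1), c (n - 1))`. -/
structure Input (s : State) (p q k n : ℕ) (A : ℕ → ℕ → ℤ) (r c : ℕ → ℕ) : Prop where
  rows : s.reg 0 = p
  cols : s.reg 1 = q
  thr : s.reg 2 = k
  num : s.reg 3 = n
  top : ∀ b : ℕ, b < q → s.mem 0 b = A 0 b
  left : ∀ a : ℕ, a < p → s.mem 1 a = A a 0
  core : ∀ m : ℕ, m < n → s.mem 2 m = r m ∧ s.mem 3 m = c m ∧ s.mem 4 m = dens A (r m) (c m)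
  list : IsCoreList p q n A r c

theorem Input.congr {s s' : State} {p q k n : ℕ} {A : ℕ → ℕ → ℤ} {r c : ℕ → ℕ}
    (h : Input s p q k n A r c) (hr : ∀ x < 4, s'.reg x = s.reg x)
    (hm : ∀ a < 5, s'.mem a = s.mem a) : Input s' p q k n A r c := by
  obtain ⟨h1, h2, h3, h4, h5, h6, h7, h8⟩ := h
  constructor
  all_goals first
    | (rw [hr _ (by norm_num)]; assumption)
    | (rw [hm _ (by norm_num)]; assumption)
    | (rw [hm 2 (by norm_num), hm 3 (by norm_num), hm 4 (by norm_num)]; assumption)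
    | assumption

theorem Input.frame {s s' : State} {p q k n : ℕ} {A : ℕ → ℕ → ℤ} {r c : ℕ → ℕ} {C : Prog}
    (h : Input s p q k n A r c) (hf : Frame C s s') (hr : ∀ x < 4, x ∉ C.regs)
    (ha : ∀ a < 5, a ∉ C.arrs) : Input s' p q k n A r c :=
  h.congr (fun x hx => hf.1 x (hr x hx)) (fun a h => hf.2 a (ha a h))

theorem Input.setReg {s : State} {p q k n : ℕ} {A : ℕ → ℕ → ℤ} {r c : ℕ → ℕ}
    (h : Input s p q k n A r c) {x : ℕ} (hx : 4 ≤ x) (v : ℤ) :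
    Input (s.setReg x v) p q k n A r c :=
  h.congr (fun y hy => by rw [reg_setReg, if_neg (by omega)]) (fun _ _ => rfl)

theorem Input.setMem {s : State} {p q k n : ℕ} {A : ℕ → ℕ → ℤ} {r c : ℕ → ℕ}
    (h : Input s p q k n A r c) {x : ℕ} (hx : 5 ≤ x) (i v : ℤ) :
    Input (s.setMem x i v) p q k n A r c :=
  h.congr (fun y _ => rfl) (fun y hy => by
    ext j
    rw [mem_setMem, if_neg (by omega)])

theorem Tree.setReg {s : State} {h : ℕ} {d : ℕ → ℤ} (ht : Tree s h d) {x : ℕ} (hx : x ≠ 10)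
    (v : ℤ) : Tree (s.setReg x v) h d :=
  ht.congr (by rw [reg_setReg, if_neg hx.symm]) rfl rfl rfl

theorem Tree.frame {s s' : State} {h : ℕ} {d : ℕ → ℤ} {C : Prog} (ht : Tree s h d)
    (hf : Frame C s s') (h0 : 10 ∉ C.regs) (h1 : 10 ∉ C.arrs) (h2 : 11 ∉ C.arrs)
    (h3 : 12 ∉ C.arrs) : Tree s' h d :=
  ht.congr (hf.1 _ h0) (hf.2 _ h1) (hf.2 _ h2) (hf.2 _ h3)

/-- Adds the value of `e₂` to the leaf with number `e₁`. -/
def treeAddAt (e₁ e₂ : Exp) : Prog := .block [.assign 20 e₁, .assign 21 e₂, treeAdd]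

theorem run_treeAddAt {s : State} {h b : ℕ} {d : ℕ → ℤ} {x : ℤ} {e₁ e₂ : Exp} (ht : Tree s h d)
    (hb : b < 2 ^ h) (h₁ : e₁.eval s = b) (h₂ : e₂.eval (s.setReg 20 b) = x) :
    Run (treeAddAt e₁ e₂) s fun t s' =>
      t ≤ e₁.cost + e₂.cost + 3 + 70 * (h + 1) ∧ Tree s' h (Function.update d b (d b + x)) := by
  simp only [treeAddAt, run_block_cons, run_assign, run_block_nil, h₁, h₂]
  refine (run_treeAdd (b := b) (x := x) ((ht.setReg (by norm_num) _).setReg (by norm_num) _)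
    hb (by simp [reg_setReg]) (by simp [reg_setReg])).mono ?_
  rintro t s' - ⟨h1, h2⟩
  exact ⟨by omega, h2⟩

/-- Leaf `b` of the tree for row `a`: the difference of the entries in columns `b` and `b - 1`.
It is `0` from column `L` on, so that these columns do not affect the prefix minima. -/
def rowDiff (A : ℕ → ℕ → ℤ) (L a b : ℕ) : ℤ := if 0 < b ∧ b < L then A a b - A a (b - 1) else 0

theorem sum_rowDiff (A : ℕ → ℕ → ℤ) {L : ℕ} (hL : 0 < L) (a b : ℕ) :
    ∑ j ∈ Finset.range (b + 1), rowDiff A L a j = A a (min b (L - 1)) - A a 0 := by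
  induction b with
  | zero => simp [rowDiff]
  | succ b ih =>
    rw [Finset.sum_range_succ, ih, rowDiff]
    by_cases hb : b + 1 < L
    · have h1 : min (b + 1) (L - 1) = b + 1 := by omega
      have h2 : min b (L - 1) = b := by omega
      simp [h1, h2, hb]
    · have h1 : min (b + 1) (L - 1) = L - 1 := by omega
      have h2 : min b (L - 1) = L - 1 := by omega
      simp [h1, h2, hb]

theorem Tree.root_le_iff_exists {s : State} {h a L q : ℕ} {A : ℕ → ℕ → ℤ}
    (ht : Tree s h (rowDiff A L a)) (hL : 0 < L) (hLq : L ≤ q) (hq : q ≤ 2 ^ h) (k : ℤ) :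
    A a 0 + s.mem 12 1 ≤ k ↔ ∃ b < L, A a b ≤ k := by
  rw [← le_sub_iff_add_le', ht.root_le_iff]
  simp only [sum_rowDiff A hL, sub_le_sub_iff_right]
  constructor
  · rintro ⟨b, -, hk⟩
    exact ⟨_, by omega, hk⟩
  · rintro ⟨b, hb, hk⟩
    refine ⟨b, by omega, ?_⟩
    rwa [min_eq_left (by omega)]

/-- Builds a tree with at least as many leaves as there are columns, all of them `0`. -/
def initTree : Prog :=
  .block [
    .assign 10 (.const 1),
    .loop (.lt (.var 10) (.var 1)) (.assign 10 (.add (.var 10) (.var 10))),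
    .forUp 11 0 10 (.block [
      .store 10 (.add (.var 11) (.var 11)) (.var 11),
      .store 10 (.add (.add (.var 11) (.var 11)) (.const 1)) (.var 11),
      .store 11 (.add (.var 11) (.var 11)) (.const 0),
      .store 11 (.add (.add (.var 11) (.var 11)) (.const 1)) (.const 0),
      .store 12 (.add (.var 11) (.var 11)) (.const 0),
      .store 12 (.add (.add (.var 11) (.var 11)) (.const 1)) (.const 0)])]

theorem run_initTree {s : State} {q : ℕ} (hq : 0 < q) (hs : s.reg 1 = q) :
    Run initTree s fun t s' =>
      t ≤ 200 * (q + 1) ∧ ∃ h, q ≤ 2 ^ h ∧ 2 ^ h ≤ 2 * q ∧ Tree s' h fun _ => 0 := by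
  rw [initTree, run_block_cons, run_assign, run_block_cons]
  refine (run_loop (I := fun φ s' => s'.reg 1 = q ∧ ∃ h, s'.reg 10 = (2 ^ h : ℕ) ∧ 2 ^ h ≤ 2 * q ∧
    φ = (2 * q - 2 ^ h) * 10) ?_ ((2 * q - 1) * 10) _ ?_).mono ?_
  · rintro φ s ⟨h1, h, h10, hle, rfl⟩ hb
    simp only [Test.eval, Exp.eval, h1, h10, Nat.cast_lt] at hb
    rw [run_assign]
    have h2 : 2 ^ (h + 1) = 2 * 2 ^ h := by ring
    have h3 : 0 < 2 ^ h := by positivity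
    refine ⟨_, ?_, by simp [reg_setReg, h1], h + 1, ?_, by omega, rfl⟩
    · simp only [Test.cost, Exp.cost]
      omega
    · simp only [reg_setReg, Exp.eval, h10, if_true, h2]
      push_cast
      ring
  · refine ⟨by simpa [reg_setReg] using hs, 0, by simp [reg_setReg, Exp.eval], by simp; omega,
      by simp⟩
  · rintro t s₁ - ⟨hb, φ', ht, h1, h, h10, hle, -⟩
    simp only [Test.eval, Exp.eval, h1, h10, Nat.cast_lt, not_lt] at hb
    rw [run_block_cons]
    have hpow : 2 ^ (h + 1) = 2 * 2 ^ h := by ring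
    refine (run_forUp (T := 60) (n := 2 ^ h) (I := fun i s' => s'.reg 10 = (2 ^ h : ℕ) ∧
      ∀ n : ℕ, n < 2 * i → s'.mem 10 n = (n / 2 : ℕ) ∧ s'.mem 11 n = 0 ∧ s'.mem 12 n = 0)
      (by norm_num) (by decide) (by decide) (Nat.zero_le _) h10
      ⟨by simp [reg_setReg, h10], by simp⟩ ?_).mono ?_
    · rintro i s₂ - hi h11 - ⟨g10, gz⟩
      simp only [run_block_cons, run_store, run_block_nil]
      refine ⟨by simp [Exp.cost], by simp [reg_setReg, reg_setMem, g10], fun n hn => ?_⟩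
      simp only [mem_setReg, mem_setMem, reg_setMem, Exp.eval, h11]
      by_cases e0 : n = i + i
      · subst e0
        simp
        omega
      by_cases e1 : n = i + i + 1
      · subst e1
        simp
        omega
      have e2 : ¬ ((n : ℤ) = i + i) := by exact_mod_cast e0
      have e3 : ¬ ((n : ℤ) = i + i + 1) := by exact_mod_cast e1
      simp [e2, e3, gz n (by omega)]
    · rintro t' s' - ⟨ht', g10, gz⟩
      rw [run_block_nil]
      simp only [Test.cost, Exp.cost] at ht ⊢
      refine ⟨by omega, h, hb, hle, by simpa using g10, fun n hn => (gz n (by omega)).1,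
        fun b hb => ?_, fun n h0 hn => ?_⟩
      · have := (gz (2 ^ h + b) (by omega)).2
        push_cast at this
        exact this
      · have e1 := (gz n (by omega)).2
        have e2 := (gz (n + n) (by omega)).2
        have e3 := (gz (n + n + 1) (by omega)).2
        push_cast at e2 e3
        simp [NodeOk, e1, e2, e3]

/-- Fills the tree with the differences of the topmost row. -/
def loadTop : Prog :=
  .forUp 11 1 1 (treeAddAt (.var 11)
    (.sub (.load 0 (.var 11)) (.load 0 (.sub (.var 11) (.const 1)))))

theorem run_loadTop {s : State} {p q k n h : ℕ} {A : ℕ → ℕ → ℤ} {r c : ℕ → ℕ}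
    (hi : Input s p q k n A r c) (hq : 0 < q) (hq2 : q ≤ 2 ^ h) (ht : Tree s h fun _ => 0) :
    Run loadTop s fun t s' => t ≤ 6 + q * (100 * (h + 1)) ∧ Input s' p q k n A r c ∧
      Tree s' h (rowDiff A q 0) := by
  refine (run_forUp (T := 90 * (h + 1)) (n := q) (I := fun i s' => Input s' p q k n A r c ∧
      Tree s' h (rowDiff A i 0)) (by norm_num) (by decide) (by decide) hq hi.cols
      ⟨hi.setReg (by norm_num) _, ?_⟩ ?_).mono ?_
  · convert ht.setReg (x := 11) (by norm_num) _ using 1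
    ext b
    exact if_neg (by omega)
  · rintro i s₁ hi0 hiq h11 - ⟨hin, htr⟩
    refine (run_treeAddAt (b := i) (x := A 0 i - A 0 (i - 1)) htr (by omega)
      (by simp [Exp.eval, h11]) ?_).mono ?_
    · have e : ((i : ℤ) - 1) = ((i - 1 : ℕ) : ℤ) := by omega
      simp [Exp.eval, mem_setReg, reg_setReg, h11, e, hin.top i hiq, hin.top (i - 1) (by omega)]
    · rintro t s' hf ⟨ht, htr'⟩
      simp only [Exp.cost] at ht
      refine ⟨by omega, (hin.frame hf (by decide) (by decide)).setReg (by norm_num) _, ?_⟩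
      convert htr'.setReg (x := 11) (by norm_num) _ using 1
      ext b
      by_cases hb : b = i
      · subst hb
        simp [rowDiff]
        omega
      · rw [Function.update_of_ne hb]
        unfold rowDiff
        congr 1
        simp only [eq_iff_iff]
        omega
  · rintro t s' - ⟨ht, h2⟩
    refine ⟨ht.trans ?_, h2⟩
    gcongr
    omega

/-- Turns the differences of the topmost row into those of the bottommost row. -/
def loadCore : Prog :=
  .forUp 11 0 3 (treeAddAt (.add (.load 3 (.var 11)) (.const 1))
    (.sub (.const 0) (.load 4 (.var 11))))

theorem rowDiff_bottom {p q n : ℕ} {A : ℕ → ℕ → ℤ} {r c : ℕ → ℕ} (h : IsCoreList p q n A r c)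
    (b : ℕ) : rowDiff A q (p - 1) b = rowDiff A q 0 b -
      ∑ m ∈ Finset.range n, if c m + 1 = b then dens A (r m) (c m) else 0 := by
  rw [h.sum_eq (fun i j => if j + 1 = b then dens A i j else 0) (fun i j h => by simp [h])]
  by_cases hb : 0 < b ∧ b < q
  · obtain ⟨b, rfl⟩ : ∃ b', b = b' + 1 := ⟨b - 1, by omega⟩
    have h1 := sum_dens A (Nat.zero_le (p - 1)) (Nat.le_succ b)
    simp only [Nat.Ico_zero_eq_range, Nat.succ_eq_add_one, Nat.Ico_succ_singleton,
      Finset.sum_singleton] at h1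
    have h2 : ∀ i, (∑ j ∈ Finset.range (q - 1), if j + 1 = b + 1 then dens A i j else 0)
        = dens A i b := by
      intro i
      simp only [Nat.add_right_cancel_iff, Finset.sum_ite_eq', Finset.mem_range]
      exact if_pos (by omega)
    simp only [h2, h1, rowDiff, hb, and_self, if_true, Nat.add_sub_cancel]
    ring
  · rw [rowDiff, rowDiff, if_neg hb, if_neg hb, Finset.sum_eq_zero]
    · simp
    · intro i _
      refine Finset.sum_eq_zero fun j hj => if_neg ?_
      rw [Finset.mem_range] at hj
      omega

theorem run_loadCore {s : State} {p q k n h : ℕ} {A : ℕ → ℕ → ℤ} {r c : ℕ → ℕ}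
    (hi : Input s p q k n A r c) (hq2 : q ≤ 2 ^ h) (ht : Tree s h (rowDiff A q 0)) :
    Run loadCore s fun t s' => t ≤ 6 + n * (100 * (h + 1)) ∧ Input s' p q k n A r c ∧
      Tree s' h (rowDiff A q (p - 1)) := by
  refine (run_forUp (T := 90 * (h + 1)) (n := n) (I := fun i s' => Input s' p q k n A r c ∧
      Tree s' h (fun b => rowDiff A q 0 b -
      ∑ m ∈ Finset.range i, if c m + 1 = b then dens A (r m) (c m) else 0))
      (by norm_num) (by decide) (by decide) (Nat.zero_le _) hi.num
      ⟨hi.setReg (by norm_num) _, by simpa using ht.setReg (by norm_num) _⟩ ?_).mono ?_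
  · rintro i s₁ - hin h11 - ⟨hI, htr⟩
    obtain ⟨-, h3, h4⟩ := hI.core i hin
    refine (run_treeAddAt (b := c i + 1) (x := - dens A (r i) (c i)) htr ?_ ?_ ?_).mono ?_
    · have := hI.list.mem i hin
      omega
    · simp [Exp.eval, h11, h3]
    · simp [Exp.eval, mem_setReg, reg_setReg, h11, h4]
    · rintro t s' hf ⟨ht, htr'⟩
      simp only [Exp.cost] at ht
      refine ⟨by omega, (hI.frame hf (by decide) (by decide)).setReg (by norm_num) _, ?_⟩
      convert htr'.setReg (x := 11) (by norm_num) _ using 1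
      ext b
      rw [Finset.sum_range_succ]
      by_cases hb : c i + 1 = b
      · subst hb
        simp
        ring
      · rw [Function.update_of_ne (Ne.symm hb), if_neg hb, add_zero]
  · rintro t s' - ⟨ht, h1, h2⟩
    refine ⟨ht.trans ?_, h1, ?_⟩
    · gcongr
      omega
    · convert h2 using 1
      ext b
      exact rowDiff_bottom hi.list b

/-! ### Linked lists of the core elements in each row -/

/-- `Linked nxt z l`: following the pointers `nxt` from `z` one meets the elements of `l` and then a
negative number. -/
inductive Linked (nxt : ℤ → ℤ) : ℤ → List ℕ → Prop
  | nil {z : ℤ} : z < 0 → Linked nxt z []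
  | cons {m : ℕ} {l : List ℕ} : Linked nxt (nxt m) l → Linked nxt m (m :: l)

theorem Linked.congr {nxt nxt' : ℤ → ℤ} {z : ℤ} {l : List ℕ} (h : Linked nxt z l)
    (he : ∀ m ∈ l, nxt' m = nxt m) : Linked nxt' z l := by
  induction h with
  | nil hz => exact .nil hz
  | cons h ih =>
    refine .cons ?_
    rw [he _ (by simp)]
    exact ih fun m hm => he m (by simp [hm])

/-- For each row `a`, array `13` points to a linked list, with pointers in array `14`, of those
among the first `n` core elements that lie between the rows `a - 1` and `a`. -/
def RowLists (s : State) (p n : ℕ) (r : ℕ → ℕ) : Prop :=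
  ∀ a < p, ∃ l, Linked (s.mem 14) (s.mem 13 a) l ∧ l.Nodup ∧ ∀ m, m ∈ l ↔ m < n ∧ r m + 1 = a

/-- Builds the linked lists, clears array `16`, and leaves in variable `14` the sum of the
threshold, the total density, and `1`. -/
def link : Prog :=
  .block [
    .forUp 11 0 0 (.block [.store 13 (.var 11) (.const (-1)), .store 16 (.var 11) (.const 0)]),
    .assign 14 (.add (.var 2) (.const 1)),
    .forUp 11 0 3 (.block [
      .store 14 (.var 11) (.load 13 (.add (.load 2 (.var 11)) (.const 1))),
      .store 13 (.add (.load 2 (.var 11)) (.const 1)) (.var 11),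
      .assign 14 (.add (.var 14) (.load 4 (.var 11)))])]

theorem run_link {s : State} {p q k n : ℕ} {A : ℕ → ℕ → ℤ} {r c : ℕ → ℕ}
    (hi : Input s p q k n A r c) :
    Run link s fun t s' => t ≤ 60 * (n + p + 1) ∧ RowLists s' p n r ∧
      s'.reg 14 = k + 1 + ∑ m ∈ Finset.range n, dens A (r m) (c m) ∧
      ∀ a < p, s'.mem 16 (a : ℕ) = 0 := by
  rw [link, run_block_cons]
  refine (run_forUp (T := 20) (n := p) (I := fun i s' =>
    ∀ a < i, s'.mem 13 (a : ℕ) = -1 ∧ s'.mem 16 (a : ℕ) = 0)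
    (by norm_num) (by decide) (by decide) (Nat.zero_le _) hi.rows (by simp) ?_).mono ?_
  · rintro i s₁ - hip h11 - hz
    simp only [run_block_cons, run_store, run_block_nil]
    refine ⟨by simp [Exp.cost], fun a ha => ?_⟩
    by_cases e : a = i
    · simp [mem_setReg, mem_setMem, reg_setMem, Exp.eval, h11, e]
    · simp [mem_setReg, mem_setMem, reg_setMem, Exp.eval, h11, e, hz a (by omega)]
  rintro t₁ s₁ hf ⟨ht₁, hz⟩
  have hi₁ : Input s₁ p q k n A r c := hi.frame hf (by decide) (by decide)
  rw [run_block_cons, run_assign, run_block_cons]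
  refine (run_forUp (T := 30) (n := n) (I := fun i s' => Input s' p q k n A r c ∧
    RowLists s' p i r ∧ s'.reg 14 = k + 1 + ∑ m ∈ Finset.range i, dens A (r m) (c m) ∧
    ∀ a < p, s'.mem 16 (a : ℕ) = 0)
    (by norm_num) (by decide) (by decide) (Nat.zero_le _)
    (by simp [reg_setReg, hi₁.num]) ⟨(hi₁.setReg (by norm_num) _).setReg (by norm_num) _,
      fun a ha => ⟨[], ?_, by simp, by simp⟩, ?_, ?_⟩ ?_).mono ?_
  · refine .nil ?_
    simp [mem_setReg, (hz a ha).1]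
  · simp [reg_setReg, Exp.eval, hi₁.thr]
  · intro a ha
    simp [mem_setReg, (hz a ha).2]
  · rintro i s₂ - hin h11 - ⟨hI, hR, h14, h16⟩
    simp only [run_block_cons, run_store, run_assign, run_block_nil]
    obtain ⟨g2, -, g4⟩ := hI.core i hin
    have hrp := (hI.list.mem i hin).1
    refine ⟨by simp [Exp.cost], (((hI.setMem (by norm_num) _ _).setMem (by norm_num) _ _).setReg
      (by norm_num) _).setReg (by norm_num) _, fun a ha => ?_, ?_, fun a ha => ?_⟩
    · obtain ⟨l, hl, hnd, hm⟩ := hR a ha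
      have hil : i ∉ l := fun h => absurd ((hm i).1 h).1 (by omega)
      have hne : ∀ m ∈ l, ¬ m = i := fun m h e => hil (e ▸ h)
      by_cases e : r i + 1 = a
      · subst e
        refine ⟨i :: l, ?_, by simp [hil, hnd], fun m => ?_⟩
        · simp only [mem_setReg, mem_setMem, reg_setMem, Exp.eval, h11, g2]
          push_cast
          simp only [if_true]
          refine .cons ?_
          refine Linked.congr (nxt := s₂.mem 14) ?_ ?_
          · simpa [mem_setMem, h11, g2] using hl
          · intro m hml
            simp [mem_setMem, hne m hml]
        · rw [List.mem_cons, hm]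
          constructor
          · rintro (rfl | h) <;> omega
          · intro h
            by_cases hmi : m = i
            · exact Or.inl hmi
            · exact Or.inr (by omega)
      · refine ⟨l, ?_, hnd, fun m => ?_⟩
        · have e' : ¬ ((a : ℤ) = r i + 1) := fun h => e (by exact_mod_cast h.symm)
          refine Linked.congr (nxt := s₂.mem 14) ?_ ?_
          · simpa [mem_setReg, mem_setMem, reg_setMem, Exp.eval, h11, g2, e'] using hl
          · intro m hml
            simp [mem_setReg, mem_setMem, Exp.eval, h11, hne m hml]
        · rw [hm]
          constructor
          · intro h
            omega
          · intro h
            have : m ≠ i := fun h' => e (h' ▸ h.2)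
            omega
    · rw [Finset.sum_range_succ]
      simp [reg_setReg, mem_setMem, reg_setMem, Exp.eval, h11, h14, g4]
      ring
    · simpa [mem_setReg, mem_setMem] using h16 a ha
  · rintro t s' - ⟨ht, -, h⟩
    rw [run_block_nil]
    simp only [Exp.cost]
    exact ⟨by omega, h⟩

/-! ### Sweeping the rows from bottom to top -/

/-- Moves the pointer in variable `12` to the left, past the columns `b` such that row `a` (in
variable `13`) has an entry at most `k` in some column up to `b`. -/
def movePointer : Prog :=
  .loop (.and (.lt (.const 0) (.var 12))
      (.not (.lt (.var 2) (.add (.load 1 (.var 13)) (.load 12 (.const 1))))))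
    (.block [
      .assign 12 (.sub (.var 12) (.const 1)),
      treeAddAt (.var 12) (.sub (.const 0) (.load 11 (.add (.var 10) (.var 12))))])

theorem run_movePointer {s : State} {p q k n h a L : ℕ} {A : ℕ → ℕ → ℤ} {r c : ℕ → ℕ}
    (hi : Input s p q k n A r c) (hq2 : q ≤ 2 ^ h) (ht : Tree s h (rowDiff A L a)) (ha : a < p)
    (h13 : s.reg 13 = a) (h12 : s.reg 12 = L) (hL : L ≤ q) :
    Run movePointer s fun t s' => ∃ L' ≤ L, t + L' * (130 * (h + 1)) ≤ L * (130 * (h + 1)) + 20 ∧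
      s'.reg 12 = L' ∧ Tree s' h (rowDiff A L' a) ∧ (∀ b < L', k < A a b) ∧
      (∀ b, L' ≤ b → b < L → ∃ b' ≤ b, A a b' ≤ k) := by
  have eval_iff : ∀ (s : State) (L' : ℕ), Input s p q k n A r c → s.reg 13 = a → s.reg 12 = L' →
      L' ≤ q → Tree s h (rowDiff A L' a) →
      (Test.eval s (.and (.lt (.const 0) (.var 12))
        (.not (.lt (.var 2) (.add (.load 1 (.var 13)) (.load 12 (.const 1)))))) ↔
      ∃ b < L', A a b ≤ k) := by
    intro s L' hi h13 h12 hL ht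
    simp only [Test.eval, Exp.eval, h12, h13, hi.thr, hi.left a ha, not_lt]
    rcases Nat.eq_zero_or_pos L' with rfl | h0
    · simp
    · rw [ht.root_le_iff_exists h0 hL hq2]
      simp [h0]
  refine (run_loop (I := fun φ s' => Input s' p q k n A r c ∧ s'.reg 13 = a ∧ ∃ L' ≤ L,
      s'.reg 12 = L' ∧ Tree s' h (rowDiff A L' a) ∧
      (∀ b, L' ≤ b → b < L → ∃ b' ≤ b, A a b' ≤ k) ∧ φ = L' * (130 * (h + 1))) ?_
      (L * (130 * (h + 1))) s ⟨hi, h13, L, le_rfl, h12, ht, fun b h1 h2 => by omega, rfl⟩).mono ?_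
  · rintro φ s₁ ⟨hI, g13, L', hLL, g12, htr, hw, rfl⟩ hb
    obtain ⟨b₀, hb₀, hk⟩ := (eval_iff s₁ L' hI g13 g12 (by omega) htr).1 hb
    obtain ⟨L₁, rfl⟩ : ∃ L₁, L' = L₁ + 1 := ⟨L' - 1, by omega⟩
    rw [run_block_cons, run_assign, run_block_cons]
    refine (run_treeAddAt (b := L₁) (x := - rowDiff A (L₁ + 1) a L₁)
      (htr.setReg (x := 12) (by norm_num) _) (by omega) ?_ ?_).mono ?_
    · simp [Exp.eval, reg_setReg, g12]
    · simp [Exp.eval, reg_setReg, mem_setReg, g12, htr.size, (htr.leaf L₁ (by omega)).1]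
    rintro t s₂ hf ⟨ht₂, htr₂⟩
    rw [run_block_nil]
    refine ⟨_, ?_, (hI.setReg (by norm_num) _).frame hf (by decide) (by decide), ?_, L₁, by omega,
      ?_, ?_, fun b h1 h2 => ?_, rfl⟩
    · simp only [Exp.cost, Test.cost] at ht₂ ⊢
      rw [add_one_mul]
      omega
    · rw [hf.1 _ (by decide)]
      simpa [reg_setReg] using g13
    · rw [hf.1 _ (by decide)]
      simp [reg_setReg, Exp.eval, g12]
    · convert htr₂ using 1
      ext b
      by_cases e : b = L₁
      · subst e
        simp [rowDiff]
      · rw [Function.update_of_ne e]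
        unfold rowDiff
        congr 1
        simp only [eq_iff_iff]
        omega
    · by_cases e : b = L₁
      · exact ⟨b₀, by omega, hk⟩
      · exact hw b (by omega) h2
  · rintro t s' - ⟨hb, φ', ht', hI, g13, L', hLL, g12, htr, hw, rfl⟩
    rw [eval_iff s' L' hI g13 g12 (by omega) htr] at hb
    push Not at hb
    simp only [Test.cost, Exp.cost] at ht'
    exact ⟨L', hLL, by omega, g12, htr, hb, hw⟩

/-- Turns the differences of row `a` into those of row `a - 1`, where variable `15` points to the
list of the core elements between these rows. -/
def moveRow : Prog :=
  .loop (.not (.lt (.var 15) (.const 0))) (.block [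
    .ite (.lt (.add (.load 3 (.var 15)) (.const 1)) (.var 12))
      (treeAddAt (.add (.load 3 (.var 15)) (.const 1)) (.load 4 (.var 15)))
      .skip,
    .assign 15 (.load 14 (.var 15))])

/-- The total density of the core elements in `l` that lie between the columns `b - 1` and `b`. -/
def pending (A : ℕ → ℕ → ℤ) (r c : ℕ → ℕ) (l : List ℕ) (b : ℕ) : ℤ :=
  (l.map fun m => if c m + 1 = b then dens A (r m) (c m) else 0).sum

theorem rowDiff_pred {p q n : ℕ} {A : ℕ → ℕ → ℤ} {r c : ℕ → ℕ} (h : IsCoreList p q n A r c)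
    {l : List ℕ} {a L : ℕ} (hl : l.Nodup) (hm : ∀ m, m ∈ l ↔ m < n ∧ r m + 1 = a) (ha : a < p)
    (hL : L ≤ q) (b : ℕ) :
    rowDiff A L a b = rowDiff A L (a - 1) b - if b < L then pending A r c l b else 0 := by
  by_cases hb : 0 < b ∧ b < L
  swap
  · have hz : (if b < L then pending A r c l b else 0) = 0 := by
      split_ifs with h'
      · refine List.sum_eq_zero fun x hx => ?_
        obtain ⟨m, -, rfl⟩ := List.mem_map.1 hx
        exact if_neg (by omega)
      · rfl
    rw [hz, rowDiff, rowDiff, if_neg hb, if_neg hb, sub_zero]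
  rw [if_pos hb.2, pending, ← List.sum_toFinset _ hl, rowDiff, rowDiff, if_pos hb, if_pos hb]
  obtain ⟨b, rfl⟩ : ∃ b', b = b' + 1 := ⟨b - 1, by omega⟩
  rcases Nat.eq_zero_or_pos a with rfl | ha0
  · rw [Finset.sum_eq_zero]
    · simp
    · intro m h'
      have := (hm m).1 (List.mem_toFinset.1 h')
      omega
  obtain ⟨a, rfl⟩ : ∃ a', a = a' + 1 := ⟨a - 1, by omega⟩
  have hsum : (∑ m ∈ l.toFinset, if c m + 1 = b + 1 then dens A (r m) (c m) else 0)
      = dens A a b := by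
    by_cases hd : dens A a b = 0
    · rw [hd]
      refine Finset.sum_eq_zero fun m hml => ?_
      have h1 := ((hm m).1 (List.mem_toFinset.1 hml)).2
      split_ifs with h2
      · rw [show r m = a by omega, show c m = b by omega, hd]
      · rfl
    · obtain ⟨m₀, hm₀, h1, h2⟩ := h.surj a b ha (by omega) hd
      rw [Finset.sum_eq_single m₀]
      · rw [if_pos (by omega), h1, h2]
      · intro m hml hne
        have h3 := (hm m).1 (List.mem_toFinset.1 hml)
        exact if_neg fun h4 => hne (h.inj m h3.1 m₀ hm₀ (by omega) (by omega))
      · intro hn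
        exact absurd (List.mem_toFinset.2 ((hm m₀).2 ⟨hm₀, by omega⟩)) hn
  rw [hsum, dens]
  simp only [Nat.add_sub_cancel]
  ring

theorem run_moveRow {s : State} {p q k n h a L : ℕ} {A : ℕ → ℕ → ℤ} {r c : ℕ → ℕ} {l : List ℕ}
    (hi : Input s p q k n A r c) (hq2 : q ≤ 2 ^ h) (ht : Tree s h (rowDiff A L a)) (ha : a < p)
    (h12 : s.reg 12 = L) (hL : L ≤ q) (hl : Linked (s.mem 14) (s.reg 15) l) (hnd : l.Nodup)
    (hm : ∀ m, m ∈ l ↔ m < n ∧ r m + 1 = a) :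
    Run moveRow s fun t s' => t ≤ l.length * (130 * (h + 1)) + 20 ∧
      Tree s' h (rowDiff A L (a - 1)) := by
  refine (run_loop (I := fun φ s' => Input s' p q k n A r c ∧ s'.reg 12 = L ∧ ∃ l,
      Linked (s'.mem 14) (s'.reg 15) l ∧ (∀ m ∈ l, m < n) ∧
      Tree s' h (fun b => rowDiff A L (a - 1) b - if b < L then pending A r c l b else 0) ∧
      φ = l.length * (130 * (h + 1))) ?_
      (l.length * (130 * (h + 1))) s ⟨hi, h12, l, hl, fun m h => ((hm m).1 h).1, ?_, rfl⟩).mono ?_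
  · rintro φ s₁ ⟨hI, g12, l', hl', hn', htr, rfl⟩ hb
    simp only [Test.eval, Exp.eval, not_lt] at hb
    generalize hz : s₁.reg 15 = z at hl' hb
    cases hl' with
    | nil h => omega
    | @cons m l' hl'' =>
      have hmn := hn' m (by simp)
      obtain ⟨-, h3, h4⟩ := hI.core m hmn
      have hmq := (hI.list.mem m hmn).2.1
      rw [run_block_cons]
      have step : Run (.ite (.lt (.add (.load 3 (.var 15)) (.const 1)) (.var 12))
          (treeAddAt (.add (.load 3 (.var 15)) (.const 1)) (.load 4 (.var 15))) .skip) s₁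
          fun t s' => t ≤ 30 + 70 * (h + 1) ∧ Tree s' h
            (fun b => rowDiff A L (a - 1) b - if b < L then pending A r c l' b else 0) := by
        rw [run_ite]
        simp only [Test.eval, Exp.eval, hz, h3, g12, run_skip]
        constructor
        · intro hlt
          have hlt' : c m + 1 < L := by exact_mod_cast hlt
          refine (run_treeAddAt (b := c m + 1) (x := dens A (r m) (c m)) htr (by omega)
            (by simp [Exp.eval, hz, h3])
            (by simp [Exp.eval, reg_setReg, mem_setReg, hz, h4])).mono ?_
          rintro t s' - ⟨ht, htr'⟩
          refine ⟨by simp only [Exp.cost, Test.cost] at ht ⊢; omega, ?_⟩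
          convert htr' using 1
          ext b
          by_cases e : c m + 1 = b
          · subst e
            simp [pending, hlt']
            ring
          · rw [Function.update_of_ne (Ne.symm e)]
            simp [pending, e]
        · intro hlt
          have hlt' : ¬ c m + 1 < L := by exact_mod_cast hlt
          refine ⟨by simp only [Exp.cost, Test.cost]; omega, ?_⟩
          convert htr using 1
          ext b
          by_cases e : b < L
          · have : c m + 1 ≠ b := by omega
            simp [pending, this]
          · simp [e]
      refine step.mono ?_
      rintro t s₂ hf ⟨ht₂, htr₂⟩
      rw [run_block_cons, run_assign, run_block_nil]
      refine ⟨_, ?_, (hI.frame hf (by decide) (by decide)).setReg (by norm_num) _, ?_, l', ?_,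
        fun m' h' => hn' m' (by simp [h']), htr₂.setReg (by norm_num) _, rfl⟩
      · simp only [Exp.cost, Test.cost, List.length_cons]
        rw [add_one_mul]
        omega
      · simp only [reg_setReg]
        rw [hf.1 12 (by decide)]
        simpa using g12
      · simp only [reg_setReg, mem_setReg, Exp.eval, if_true]
        rw [hf.1 15 (by decide), hf.2 14 (by decide), hz]
        exact hl''
  · convert ht using 1
    ext b
    exact (rowDiff_pred hi.list hnd hm ha hL b).symm
  · rintro t s' - ⟨hb, φ', ht', hI, g12, l', hl', hn', htr, rfl⟩
    simp only [Test.eval, Exp.eval, not_not] at hb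
    have hnil : l' = [] := by
      generalize s'.reg 15 = z at hl' hb
      cases hl' with
      | nil h => rfl
      | cons h => omega
    subst hnil
    simp only [Test.cost, Exp.cost] at ht'
    exact ⟨by omega, by simpa [pending] using htr⟩

/-- Writes the function `L` of `Leftmost` to array `15`. Variable `13` holds the current row, and
variable `12` the leftmost column not yet passed. -/
def sweep : Prog :=
  .block [
    .assign 12 (.var 1),
    .assign 13 (.var 0),
    .loop (.lt (.const 0) (.var 13)) (.block [
      .assign 13 (.sub (.var 13) (.const 1)),
      movePointer,
      .store 15 (.var 13) (.var 12),
      .assign 15 (.load 13 (.var 13)),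
      moveRow])]

theorem run_sweep {s : State} {p q k n h : ℕ} {A : ℕ → ℕ → ℤ} {r c : ℕ → ℕ}
    (hi : Input s p q k n A r c) (hq2 : q ≤ 2 ^ h) (ht : Tree s h (rowDiff A q (p - 1)))
    (hr : RowLists s p n r) :
    Run sweep s fun t s' => t ≤ 20 + (p + q + n) * (200 * (h + 1)) ∧
      ∃ L, Leftmost p q k A L ∧ ∀ a < p, s'.mem 15 (a : ℕ) = L a := by
  let cnt : ℕ → ℕ := fun a => ((Finset.range n).filter fun m => r m + 1 < a).card
  have hcnt : cnt p ≤ n := (Finset.card_filter_le _ _).trans (by simp)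
  have hcs : ∀ (a : ℕ) (l : List ℕ), l.Nodup → (∀ m, m ∈ l ↔ m < n ∧ r m + 1 = a) →
      cnt (a + 1) = cnt a + l.length := by
    intro a l hnd hm
    rw [← List.toFinset_card_of_nodup hnd, ← Finset.card_union_of_disjoint]
    · refine congrArg Finset.card ?_
      ext m
      simp only [Finset.mem_filter, Finset.mem_range, Finset.mem_union, List.mem_toFinset, hm]
      omega
    · rw [Finset.disjoint_left]
      intro m h1 h2
      rw [Finset.mem_filter] at h1
      rw [List.mem_toFinset, hm] at h2
      omega
  rw [sweep, run_block_cons, run_assign, run_block_cons, run_assign, run_block_cons]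
  -- the potential pays for the remaining rows, pointer moves, and core elements
  refine (run_loop (I := fun φ s' => Input s' p q k n A r c ∧ RowLists s' p n r ∧
    ∃ (a L : ℕ) (F : ℕ → ℕ), a ≤ p ∧ L ≤ q ∧ s'.reg 13 = a ∧ s'.reg 12 = L ∧
      Tree s' h (rowDiff A L (a - 1)) ∧
      (∀ b < q, L ≤ b → ∃ a' b', a ≤ a' ∧ a' < p ∧ b' ≤ b ∧ A a' b' ≤ k) ∧
      (∀ a', a ≤ a' → a' < p → s'.mem 15 (a' : ℕ) = F a' ∧ L ≤ F a' ∧ F a' ≤ q ∧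
        (∀ b < F a', k < A a' b) ∧
        ∀ b < q, F a' ≤ b → ∃ a'' b', a' ≤ a'' ∧ a'' < p ∧ b' ≤ b ∧ A a'' b' ≤ k) ∧
      (∀ a₁ a₂, a ≤ a₁ → a₁ ≤ a₂ → a₂ < p → F a₁ ≤ F a₂) ∧
      φ = a * (200 * (h + 1)) + L * (130 * (h + 1)) + cnt a * (130 * (h + 1))) ?_
      (p * (200 * (h + 1)) + q * (130 * (h + 1)) + cnt p * (130 * (h + 1))) _ ?_).mono ?_
  · rintro φ s₁ ⟨hI, hR, a₁, L, F, hap, hLq, h13, h12, htr, hw, hF, hmono, rfl⟩ hb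
    simp only [Test.eval, Exp.eval, h13, Nat.cast_pos] at hb
    obtain ⟨a, rfl⟩ : ∃ a, a₁ = a + 1 := ⟨a₁ - 1, by omega⟩
    rw [run_block_cons, run_assign, run_block_cons]
    refine (run_movePointer (a := a) (L := L) (hI.setReg (by norm_num) _) hq2
      (htr.setReg (by norm_num) _) (by omega) (by simp [reg_setReg, Exp.eval, h13])
      (by simp [reg_setReg, h12]) hLq).mono ?_
    rintro t₂ s₂ hf₂ ⟨L', hL', ht₂, h12', htr₂, hgt, hw₂⟩
    have hI₂ := (hI.setReg (by norm_num) _).frame hf₂ (by decide) (by decide)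
    have h13' : s₂.reg 13 = a := by
      rw [hf₂.1 13 (by decide)]
      simp [reg_setReg, Exp.eval, h13]
    have m13 : s₂.mem 13 = s₁.mem 13 := hf₂.2 13 (by decide)
    have m14 : s₂.mem 14 = s₁.mem 14 := hf₂.2 14 (by decide)
    have m15 : s₂.mem 15 = s₁.mem 15 := hf₂.2 15 (by decide)
    obtain ⟨l, hl, hnd, hm⟩ := hR a (by omega)
    rw [run_block_cons, run_store, run_block_cons, run_assign, run_block_cons]
    refine (run_moveRow (a := a) (L := L') (l := l)
      ((hI₂.setMem (by norm_num) _ _).setReg (by norm_num) _) hq2 ?_ (by omega)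
      (by simp [reg_setReg, reg_setMem, h12']) (by omega) ?_ hnd hm).mono ?_
    · exact htr₂.congr (by simp [reg_setReg, reg_setMem])
        (by ext; simp [mem_setReg, mem_setMem]) (by ext; simp [mem_setReg, mem_setMem])
        (by ext; simp [mem_setReg, mem_setMem])
    · refine Linked.congr (nxt := s₁.mem 14) ?_ ?_
      · simpa [reg_setReg, reg_setMem, Exp.eval, mem_setMem, h13', m13] using hl
      · intro m _
        simp [mem_setReg, mem_setMem, m14]
    rintro t₃ s₃ hf₃ ⟨ht₃, htr₃⟩
    have hI₃ := ((hI₂.setMem (x := 15) (by norm_num) (Exp.eval s₂ (.var 13))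
      (Exp.eval s₂ (.var 12))).setReg (x := 15) (by norm_num) _).frame hf₃
      (by decide) (by decide)
    have n13 : s₃.mem 13 = s₁.mem 13 := by
      rw [hf₃.2 13 (by decide), ← m13]
      ext
      simp [mem_setReg, mem_setMem]
    have n14 : s₃.mem 14 = s₁.mem 14 := by
      rw [hf₃.2 14 (by decide), ← m14]
      ext
      simp [mem_setReg, mem_setMem]
    have n15 : ∀ j : ℕ, s₃.mem 15 j = if j = a then (L' : ℤ) else s₁.mem 15 j := by
      intro j
      rw [hf₃.2 15 (by decide), ← m15]
      simp [mem_setReg, mem_setMem, Exp.eval, h13', h12']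
    have hw' : ∀ b < q, L' ≤ b → ∃ a' b', a ≤ a' ∧ a' < p ∧ b' ≤ b ∧ A a' b' ≤ k := by
      intro b hb1 hb2
      by_cases hbL : b < L
      · obtain ⟨b', hb', hk⟩ := hw₂ b hb2 hbL
        exact ⟨a, b', le_rfl, by omega, hb', hk⟩
      · obtain ⟨a', b', h1, h2⟩ := hw b hb1 (by omega)
        exact ⟨a', b', by omega, h2⟩
    rw [run_block_nil]
    refine ⟨_, ?_, hI₃, ?_, a, L', Function.update F a L', by omega, by omega, ?_, ?_, htr₃, hw',
      fun a' h1 h2 => ?_, fun a₁ a₂ h1 h2 h3 => ?_, rfl⟩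
    · rw [hcs a l hnd hm, add_mul (cnt a), add_one_mul a]
      simp only [Exp.cost, Test.cost]
      omega
    · unfold RowLists
      rw [n13, n14]
      exact hR
    · rw [hf₃.1 13 (by decide)]
      simp [reg_setReg, reg_setMem, h13']
    · rw [hf₃.1 12 (by decide)]
      simp [reg_setReg, reg_setMem, h12']
    · by_cases e : a' = a
      · subst e
        rw [Function.update_self]
        exact ⟨by simp [n15], le_rfl, by omega, hgt, hw'⟩
      · obtain ⟨g1, g2, g3⟩ := hF a' (by omega) h2
        rw [Function.update_of_ne e]
        exact ⟨by simp [n15, e, g1], by omega, g3⟩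
    · by_cases e₂ : a₂ = a
      · rw [show a₁ = a by omega, e₂]
      · rw [Function.update_of_ne e₂]
        by_cases e₁ : a₁ = a
        · rw [e₁, Function.update_self]
          have := (hF a₂ (by omega) h3).2.1
          omega
        · rw [Function.update_of_ne e₁]
          exact hmono _ _ (by omega) h2 h3
  · refine ⟨(hi.setReg (by norm_num) _).setReg (by norm_num) _, hr, p, q, fun _ => 0, le_rfl,
      le_rfl, ?_, ?_, (ht.setReg (by norm_num) _).setReg (by norm_num) _, fun b _ _ => by omega,
      fun a _ _ => by omega, fun _ _ _ _ _ => le_rfl, rfl⟩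
    · simp [reg_setReg, Exp.eval, hi.rows]
    · simp [reg_setReg, Exp.eval, hi.cols]
  · rintro t s' - ⟨hb, φ', ht', -, -, a, L, F, hap, hLq, h13, -, -, -, hF, hmono, -⟩
    simp only [Test.eval, Exp.eval, h13, Nat.cast_pos] at hb
    rw [run_block_nil]
    refine ⟨?_, F, ⟨fun a' h => ?_, fun a₁ a₂ h1 h2 => ?_, fun a' h => ?_, fun a' h => ?_⟩,
      fun a' h => ?_⟩
    · simp only [Exp.cost, Test.cost] at ht' ⊢
      have h1 := Nat.mul_le_mul_right (130 * (h + 1)) hcnt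
      have h2 : n * (130 * (h + 1)) ≤ n * (200 * (h + 1)) := Nat.mul_le_mul_left _ (by omega)
      have h3 : q * (130 * (h + 1)) ≤ q * (200 * (h + 1)) := Nat.mul_le_mul_left _ (by omega)
      rw [add_mul, add_mul]
      omega
    · exact (hF a' (by omega) h).2.2.1
    · exact hmono a₁ a₂ (by omega) h1 h2
    · exact (hF a' (by omega) h).2.2.2.1
    · exact (hF a' (by omega) h).2.2.2.2
    · exact (hF a' (by omega) h).1

/-! ### Writing the new core -/

/-- The first variable-`15` entries of the arrays `2`, `3`, `4` list the cells in `l`, transposed,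
with the densities of the matrix `A`. -/
def Cells (s : State) (A : ℕ → ℕ → ℤ) (l : List (ℕ × ℕ)) : Prop :=
  s.reg 15 = l.length ∧ ∀ (m : ℕ) (hm : m < l.length),
    s.mem 2 m = l[m].2 ∧ s.mem 3 m = l[m].1 ∧ s.mem 4 m = dens A l[m].1 l[m].2

theorem Cells.setReg {s : State} {A : ℕ → ℕ → ℤ} {l : List (ℕ × ℕ)} (h : Cells s A l) {x : ℕ}
    (hx : x ≠ 15) (v : ℤ) : Cells (s.setReg x v) A l :=
  ⟨by rw [reg_setReg, if_neg hx.symm]; exact h.1, h.2⟩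

/-- Appends the cell in the variables `20`, `21`, with the density in variable `22`. -/
def pushCell : Prog :=
  .block [.store 2 (.var 15) (.var 21), .store 3 (.var 15) (.var 20), .store 4 (.var 15) (.var 22),
    .assign 15 (.add (.var 15) (.const 1))]

theorem run_pushCell {s : State} {A : ℕ → ℕ → ℤ} {l : List (ℕ × ℕ)} {i j : ℕ}
    (hl : Cells s A l) (h20 : s.reg 20 = i) (h21 : s.reg 21 = j) (h22 : s.reg 22 = dens A i j) :
    Run pushCell s fun t s' => t ≤ 20 ∧ Cells s' A (l ++ [(i, j)]) ∧
      ∀ (m : ℕ), l.length < m →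
        s'.mem 2 m = s.mem 2 m ∧ s'.mem 3 m = s.mem 3 m ∧ s'.mem 4 m = s.mem 4 m := by
  obtain ⟨h15, hc⟩ := hl
  simp only [pushCell, run_block_cons, run_store, run_assign, run_block_nil]
  refine ⟨by simp [Exp.cost], ⟨?_, fun m hm => ?_⟩, fun m hm => ?_⟩
  · simp [reg_setReg, reg_setMem, Exp.eval, h15]
  · by_cases e : m < l.length
    · simp [mem_setReg, mem_setMem, reg_setMem, Exp.eval, h15, List.getElem_append_left e, hc m e,
        e.ne]
    · have e' : m = l.length := by
        simp at hm
        omega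
      subst e'
      simp [mem_setReg, mem_setMem, reg_setMem, Exp.eval, h15, h20, h21, h22]
  · have : m ≠ l.length := by omega
    simp [mem_setReg, mem_setMem, reg_setMem, Exp.eval, h15, this]

/-- Removes the core elements `(i, j, v)` with `j < L (i + 1)`, and adds up their values for each
row in array `16`. -/
def filterCore : Prog :=
  .seq (.assign 15 (.const 0)) (.forUp 11 0 3 (.block [
      .assign 20 (.load 2 (.var 11)),
      .assign 21 (.load 3 (.var 11)),
      .assign 22 (.load 4 (.var 11)),
      .ite (.lt (.var 21) (.load 15 (.add (.var 20) (.const 1))))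
        (.store 16 (.add (.var 20) (.const 1))
          (.add (.load 16 (.add (.var 20) (.const 1))) (.var 22)))
        pushCell]))

/-- Adds the core elements in the cells `(i, L (i + 1) - 1)`. -/
def addStairs : Prog :=
  .seq (.assign 22 (.var 14)) (.forUp 11 1 0 (.block [
      .assign 20 (.sub (.var 11) (.const 1)),
      .assign 21 (.sub (.load 15 (.var 11)) (.const 1)),
      .ite (.and (.lt (.const 0) (.load 15 (.var 11))) (.lt (.load 15 (.var 11)) (.var 1)))
        pushCell .skip]))

theorem run_filterCore {s : State} {p q k n : ℕ} {A A' : ℕ → ℕ → ℤ} {r c L : ℕ → ℕ}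
    (hi : Input s p q k n A r c) (hL : ∀ a < p, s.mem 15 (a : ℕ) = L a)
    (h16 : ∀ a < p, s.mem 16 (a : ℕ) = 0)
    (hA' : ∀ i j, i + 1 < p → j + 1 < q → L (i + 1) ≤ j → dens A' i j = dens A i j) :
    Run filterCore s fun t s' => t ≤ 20 + n * 80 ∧ ∃ l : List (ℕ × ℕ), Cells s' A' l ∧ l.Nodup ∧
      (∀ x, x ∈ l ↔ ∃ m < n, x = (r m, c m) ∧ L (r m + 1) ≤ c m) ∧
      ∀ a < p, s'.mem 16 (a : ℕ) =
        ∑ m ∈ Finset.range n, if r m + 1 = a ∧ c m < L a then dens A (r m) (c m) else 0 := by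
  rw [filterCore, run_seq, run_assign]
  -- the kept elements are written in place, never past the element being read
  refine Run.mono (run_forUp (T := 60) (n := n) (I := fun i s' =>
    (∀ a < p, s'.mem 15 (a : ℕ) = L a) ∧
    (∀ m : ℕ, i ≤ m → m < n →
      s'.mem 2 m = r m ∧ s'.mem 3 m = c m ∧ s'.mem 4 m = dens A (r m) (c m)) ∧
    ∃ l : List (ℕ × ℕ), Cells s' A' l ∧ l.Nodup ∧ l.length ≤ i ∧
      (∀ x, x ∈ l ↔ ∃ m < i, x = (r m, c m) ∧ L (r m + 1) ≤ c m) ∧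
      ∀ a < p, s'.mem 16 (a : ℕ) =
        ∑ m ∈ Finset.range i, if r m + 1 = a ∧ c m < L a then dens A (r m) (c m) else 0)
    (by norm_num) (by decide) (by decide) (Nat.zero_le _)
    (by simp [reg_setReg, hi.num]) ⟨hL, fun m _ => hi.core m, [], ?_, by simp, by simp, by simp,
      by simpa [mem_setReg] using h16⟩ ?_) ?_
  · simp [Cells, reg_setReg, Exp.eval]
  · rintro i s₁ - hin h11 - ⟨g15, gc, l, hl, hnd, hle, hm, g16⟩
    obtain ⟨g2, g3, g4⟩ := gc i le_rfl hin
    obtain ⟨hrp, hcq, -⟩ := hi.list.mem i hin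
    have g15' := g15 _ hrp
    push_cast at g15'
    simp only [run_block_cons, run_assign, run_ite, run_store, run_block_nil, Test.eval, Exp.eval,
      reg_setReg, mem_setReg, if_true, Nat.reduceEqDiff, if_false, h11, g2,
      g3, g4, g15', Nat.cast_lt]
    constructor
    · intro hlt
      refine ⟨by simp [Exp.cost, Test.cost], g15, ?_, l, ?_, hnd, by omega, fun x => ?_,
        fun a ha => ?_⟩
      · intro m h1 h2
        simpa [mem_setReg, mem_setMem] using gc m (by omega) h2
      · simpa [Cells, mem_setReg, mem_setMem, reg_setMem, reg_setReg] using hl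
      · rw [hm]
        constructor
        · rintro ⟨m, h1, h2⟩
          exact ⟨m, by omega, h2⟩
        · rintro ⟨m, h1, h2, h3⟩
          have : m ≠ i := by
            rintro rfl
            omega
          exact ⟨m, by omega, h2, h3⟩
      · have := g16 _ hrp
        push_cast at this
        rw [Finset.sum_range_succ]
        by_cases e : a = r i + 1
        · subst e
          simp [mem_setMem, this, hlt]
        · have e' : ¬ ((a : ℤ) = r i + 1) := by exact_mod_cast e
          simp [mem_setReg, mem_setMem, g16 a ha, e', Ne.symm e]
    · intro hlt
      refine (run_pushCell (A := A') (l := l) (i := r i) (j := c i) ?_ ?_ ?_ ?_).mono ?_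
      · exact ((hl.setReg (by norm_num) _).setReg (by norm_num) _).setReg (by norm_num) _
      · simp [reg_setReg]
      · simp [reg_setReg]
      · simp [reg_setReg, hA' _ _ hrp hcq (by omega)]
      rintro t s₂ hf ⟨ht, hl₂, hrest⟩
      have k15 : s₂.mem 15 = s₁.mem 15 := hf.2 15 (by decide)
      have k16 : s₂.mem 16 = s₁.mem 16 := hf.2 16 (by decide)
      refine ⟨by simp only [Exp.cost, Test.cost]; omega, ?_, fun m h1 h2 => ?_, _,
        hl₂.setReg (by norm_num) _, ?_, ?_, fun x => ?_, fun a ha => ?_⟩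
      · simpa [mem_setReg, k15] using g15
      · obtain ⟨f2, f3, f4⟩ := hrest m (by omega)
        simp only [mem_setReg, f2, f3, f4]
        exact gc m (by omega) h2
      · rw [List.nodup_append]
        refine ⟨hnd, by simp, ?_⟩
        rintro x hx y hy rfl
        obtain ⟨m, h1, h2, -⟩ := (hm x).1 hx
        simp only [List.mem_singleton] at hy
        rw [h2, Prod.mk.injEq] at hy
        have := hi.list.inj m (by omega) i hin hy.1 hy.2
        omega
      · simp
        omega
      · rw [List.mem_append, List.mem_singleton, hm]
        constructor
        · rintro (⟨m, h1, h2⟩ | rfl)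
          · exact ⟨m, by omega, h2⟩
          · exact ⟨i, by omega, rfl, by omega⟩
        · rintro ⟨m, h1, h2, h3⟩
          by_cases e : m = i
          · subst e
            exact Or.inr h2
          · exact Or.inl ⟨m, by omega, h2, h3⟩
      · rw [Finset.sum_range_succ, if_neg, add_zero]
        · rw [← g16 a ha, ← k16]
        · rintro ⟨rfl, h⟩
          exact hlt h
  · rintro t s' - ⟨ht, -, -, l, h1, h2, -, h3, h4⟩
    exact ⟨by simp only [Exp.cost]; omega, l, h1, h2, h3, h4⟩

theorem run_addStairs {s : State} {p q : ℕ} {A' : ℕ → ℕ → ℤ} {L : ℕ → ℕ} {l₀ : List (ℕ × ℕ)}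
    (hp : 0 < p) (h0 : s.reg 0 = p) (h1 : s.reg 1 = q) (hL : ∀ a < p, s.mem 15 (a : ℕ) = L a)
    (hA' : ∀ i, i + 1 < p → 0 < L (i + 1) → L (i + 1) < q →
      dens A' i (L (i + 1) - 1) = s.reg 14)
    (hl₀ : Cells s A' l₀) (hnd : l₀.Nodup) (hm₀ : ∀ x ∈ l₀, L (x.1 + 1) ≤ x.2) :
    Run addStairs s fun t s' => t ≤ 20 + p * 80 ∧ ∃ l : List (ℕ × ℕ), Cells s' A' l ∧ l.Nodup ∧
      ∀ x, x ∈ l ↔ x ∈ l₀ ∨ (x.1 + 1 < p ∧ x.2 + 1 < q ∧ L (x.1 + 1) = x.2 + 1) := by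
  rw [addStairs, run_seq, run_assign]
  refine Run.mono (run_forUp (T := 60) (n := p) (I := fun i s' => s'.reg 1 = q ∧
    s'.reg 22 = s.reg 14 ∧ (∀ a < p, s'.mem 15 (a : ℕ) = L a) ∧
    ∃ l : List (ℕ × ℕ), Cells s' A' l ∧ l.Nodup ∧
      ∀ x, x ∈ l ↔ x ∈ l₀ ∨ (x.1 + 1 < i ∧ x.2 + 1 < q ∧ L (x.1 + 1) = x.2 + 1))
    (by norm_num) (by decide) (by decide) hp
    (by simp [reg_setReg, h0]) ⟨by simp [reg_setReg, h1], by simp [reg_setReg, Exp.eval], hL, l₀,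
      by simpa [Cells, reg_setReg, mem_setReg] using hl₀, hnd, by simp⟩ ?_) ?_
  · rintro i s₁ hi0 hip h11 - ⟨g1, g22, g15, l, hl, hnd, hm⟩
    obtain ⟨i, rfl⟩ : ∃ i', i = i' + 1 := ⟨i - 1, by omega⟩
    have g15' := g15 _ hip
    push_cast at g15' h11
    simp only [run_block_cons, run_assign, run_ite, run_skip, run_block_nil, Test.eval, Exp.eval,
      reg_setReg, mem_setReg, Nat.reduceEqDiff, if_false, h11,
      g15', g1, Nat.cast_lt, Nat.cast_pos]
    constructor
    · rintro ⟨hL0, hLq⟩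
      obtain ⟨j, hj⟩ : ∃ j, L (i + 1) = j + 1 := ⟨L (i + 1) - 1, by omega⟩
      have hd := hA' i hip hL0 hLq
      rw [hj, Nat.add_sub_cancel] at hd
      refine (run_pushCell (A := A') (l := l) (i := i) (j := j) ?_ ?_ ?_ ?_).mono ?_
      · exact (hl.setReg (by norm_num) _).setReg (by norm_num) _
      · simp [reg_setReg]
      · simp [reg_setReg, hj]
      · simp [reg_setReg, hd, g22]
      rintro t s₂ hf ⟨ht, hl₂, -⟩
      have k15 : s₂.mem 15 = s₁.mem 15 := hf.2 15 (by decide)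
      have k22 := hf.1 22 (by decide)
      have k1 := hf.1 1 (by decide)
      simp only [reg_setReg, Nat.reduceEqDiff, if_false, g1, g22,
        OfNat.one_ne_ofNat] at k22 k1
      refine ⟨by simp only [Exp.cost, Test.cost]; omega, by simp [k1],
        by simp [k22], by simpa [mem_setReg, k15] using g15, _,
        hl₂.setReg (by norm_num) _, ?_, fun x => ?_⟩
      · rw [List.nodup_append]
        refine ⟨hnd, by simp, ?_⟩
        rintro x hx y hy rfl
        simp only [List.mem_singleton] at hy
        subst hy
        rcases (hm _).1 hx with h | h
        · have := hm₀ _ h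
          simp only at this
          omega
        · simp at h
      · rw [List.mem_append, List.mem_singleton, hm, or_assoc]
        refine or_congr_right ?_
        constructor
        · rintro (h | rfl)
          · omega
          · exact ⟨by simp, by simp only; omega, hj⟩
        · rintro ⟨h2, h3, h4⟩
          by_cases e : x.1 = i
          · right
            rw [e] at h4
            ext
            · exact e
            · simp only
              omega
          · left
            omega
    · intro hn
      refine ⟨by simp [Exp.cost, Test.cost], by simp,
        by simp [g22], by simpa [mem_setReg] using g15, l,
        ((hl.setReg (by norm_num) _).setReg (by norm_num) _).setReg (by norm_num) _, hnd,
        fun x => ?_⟩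
      rw [hm]
      refine or_congr_right ?_
      constructor
      · omega
      · rintro ⟨h2, h3, h4⟩
        have : x.1 ≠ i := by
          intro e
          rw [e] at h4
          exact hn ⟨by omega, by omega⟩
        omega
  · rintro t s' - ⟨ht, -, -, -, l, h1, h2, h3⟩
    exact ⟨by simp only [Exp.cost]; omega, l, h1, h2, h3⟩

/-! ### Writing the new borders -/

/-- Replaces the dimensions, the topmost row, the leftmost column, and the size of the core by
those of the transpose of the new matrix. -/
def borders : Prog :=
  .block [
    .assign 20 (.const 0),
    .forUp 11 0 0 (.block [
      .ite (.lt (.const 0) (.load 15 (.var 11))) (.assign 20 (.add (.var 20) (.var 14))) .skip,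
      .assign 20 (.sub (.var 20) (.load 16 (.var 11))),
      .store 17 (.var 11) (.add (.load 1 (.var 11)) (.var 20))]),
    .forUp 11 0 1 (.ite (.lt (.var 11) (.load 15 (.const 0)))
      (.store 1 (.var 11) (.add (.load 0 (.var 11)) (.var 14)))
      (.store 1 (.var 11) (.load 0 (.var 11)))),
    .forUp 11 0 0 (.store 0 (.var 11) (.load 17 (.var 11))),
    .assign 20 (.var 0),
    .assign 0 (.var 1),
    .assign 1 (.var 20),
    .assign 3 (.var 15)]

theorem run_borders {s : State} {p q : ℕ} {A : ℕ → ℕ → ℤ} {L : ℕ → ℕ} {D : ℕ → ℤ} {B : ℤ}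
    (hp : 0 < p) (h0 : s.reg 0 = p) (h1 : s.reg 1 = q) (h14 : s.reg 14 = B)
    (htop : ∀ b < q, s.mem 0 (b : ℕ) = A 0 b) (hleft : ∀ a < p, s.mem 1 (a : ℕ) = A a 0)
    (h15 : ∀ a < p, s.mem 15 (a : ℕ) = L a) (h16 : ∀ a < p, s.mem 16 (a : ℕ) = D a) :
    Run borders s fun t s' => t ≤ 100 + (p + q) * 100 ∧ s'.reg 0 = q ∧ s'.reg 1 = p ∧
      s'.reg 3 = s.reg 15 ∧
      (∀ b < q, s'.mem 1 (b : ℕ) = A 0 b + if b < L 0 then B else 0) ∧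
      ∀ a < p, s'.mem 0 (a : ℕ) = A a 0 + ((∑ a' ∈ Finset.range (a + 1), if 0 < L a' then B else 0)
        - ∑ a' ∈ Finset.range (a + 1), D a') := by
  rw [borders, run_block_cons, run_assign, run_block_cons]
  refine Run.mono (run_forUp (T := 30) (n := p) (I := fun i s' =>
    s'.reg 14 = B ∧ (∀ a < p, s'.mem 1 (a : ℕ) = A a 0) ∧
    (∀ a < p, s'.mem 15 (a : ℕ) = L a) ∧ (∀ a < p, s'.mem 16 (a : ℕ) = D a) ∧
    s'.reg 20 = (∑ a' ∈ Finset.range i, if 0 < L a' then B else 0)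
        - ∑ a' ∈ Finset.range i, D a' ∧
    ∀ a < i, s'.mem 17 (a : ℕ) =
      A a 0 + ((∑ a' ∈ Finset.range (a + 1), if 0 < L a' then B else 0)
        - ∑ a' ∈ Finset.range (a + 1), D a'))
    (by norm_num) (by decide) (by decide) (Nat.zero_le _) (by simp [reg_setReg, h0])
    ⟨by simp [reg_setReg, h14], hleft, h15, h16, by simp [reg_setReg, Exp.eval], by simp⟩ ?_) ?_
  · rintro i s₁ - hip h11 - ⟨g14, gl, g15, g16, g20, g17⟩
    -- in either branch, `v` is the value of variable `20` after the conditional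
    have fin : ∀ v : ℤ, v = s₁.reg 20 + (if 0 < L i then B else 0) →
        ((∀ a < i + 1, (if (a : ℤ) = i then A i 0 + (v - D i) else s₁.mem 17 (a : ℕ)) =
          A a 0 + ((∑ a' ∈ Finset.range (a + 1), if 0 < L a' then B else 0)
          - ∑ a' ∈ Finset.range (a + 1), D a')) ∧
        v - D i = (∑ a' ∈ Finset.range (i + 1), if 0 < L a' then B else 0)
        - ∑ a' ∈ Finset.range (i + 1), D a') := by
      rintro v rfl
      have h2 : s₁.reg 20 + (if 0 < L i then B else 0) - D i =
          (∑ a' ∈ Finset.range (i + 1), if 0 < L a' then B else 0)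
          - ∑ a' ∈ Finset.range (i + 1), D a' := by
        rw [Finset.sum_range_succ, Finset.sum_range_succ, g20]
        ring
      refine ⟨fun a ha => ?_, h2⟩
      by_cases e : a = i
      · subst e
        rw [if_pos rfl, h2]
      · rw [if_neg (by exact_mod_cast e)]
        exact g17 a (by omega)
    simp only [run_block_cons, run_assign, run_ite, run_skip, run_store, run_block_nil, Test.eval,
      Exp.eval, reg_setReg, mem_setReg, reg_setMem, mem_setMem, if_true, Nat.reduceEqDiff,
      if_false, h11, g15 i hip, g16 i hip, gl i hip, g14, Nat.cast_pos]
    constructor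
    · intro hL
      obtain ⟨f1, f2⟩ := fin (s₁.reg 20 + B) (by simp [hL])
      exact ⟨by simp [Exp.cost, Test.cost], by simp, by simpa using gl, by simpa using g15,
        by simpa using g16, by simpa using f2, by simpa using f1⟩
    · intro hL
      obtain ⟨f1, f2⟩ := fin (s₁.reg 20) (by simp [hL])
      exact ⟨by simp [Exp.cost, Test.cost], by simp, by simpa using gl, by simpa using g15,
        by simpa using g16, by simpa using f2, by simpa using f1⟩
  rintro t₁ s₁ hf₁ ⟨ht₁, g14, -, g15, -, -, g17⟩
  have k0 : s₁.reg 0 = p := by rw [hf₁.1 0 (by decide)]; simp [reg_setReg, h0]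
  have k1 : s₁.reg 1 = q := by rw [hf₁.1 1 (by decide)]; simp [reg_setReg, h1]
  have k15 : s₁.reg 15 = s.reg 15 := by rw [hf₁.1 15 (by decide)]; simp [reg_setReg]
  have m0 : s₁.mem 0 = s.mem 0 := hf₁.2 0 (by decide)
  rw [run_block_cons]
  refine Run.mono (run_forUp (T := 20) (n := q) (I := fun i s' =>
    s'.reg 14 = B ∧ (∀ b < q, s'.mem 0 (b : ℕ) = A 0 b) ∧ s'.mem 15 0 = L 0 ∧
    ∀ b < i, s'.mem 1 (b : ℕ) = A 0 b + if b < L 0 then B else 0)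
    (by norm_num) (by decide) (by decide) (Nat.zero_le _) k1
    ⟨by simp [reg_setReg, g14], by simpa [mem_setReg, m0] using htop, g15 0 hp, by simp⟩ ?_) ?_
  · rintro i s₂ - hiq h11 - ⟨f14, f0, f15, f1⟩
    simp only [run_ite, run_store, Test.eval, Exp.eval, h11, f15, f0 i hiq, f14, Nat.cast_lt,
      reg_setReg, mem_setReg, reg_setMem, mem_setMem]
    constructor
    · intro hL
      refine ⟨by simp [Exp.cost, Test.cost], by simp, by simpa using f0, by simp,
        fun b hb => ?_⟩
      by_cases e : b = i
      · simp [e, hL]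
      · simp [e, f1 b (by omega)]
    · intro hL
      refine ⟨by simp [Exp.cost, Test.cost], by simp, by simpa using f0, by simp,
        fun b hb => ?_⟩
      by_cases e : b = i
      · simp [e, hL]
      · simp [e, f1 b (by omega)]
  rintro t₂ s₂ hf₂ ⟨ht₂, -, -, -, f1⟩
  rw [run_block_cons]
  refine Run.mono (run_forUp (T := 20) (n := p) (I := fun i s' =>
    s'.mem 17 = s₁.mem 17 ∧ ∀ a < i, s'.mem 0 (a : ℕ) = s₁.mem 17 (a : ℕ))
    (by norm_num) (by decide) (by decide) (Nat.zero_le _) ((hf₂.1 0 (by decide)).trans k0)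
    ⟨hf₂.2 17 (by decide), by simp⟩ ?_) ?_
  · rintro i s₃ - hip h11 - ⟨e17, e0⟩
    rw [run_store]
    refine ⟨by simp [Exp.cost], ?_, fun a ha => ?_⟩
    · ext
      simp [mem_setReg, mem_setMem, e17]
    · by_cases e : a = i
      · simp [mem_setReg, mem_setMem, Exp.eval, h11, e, e17]
      · simp [mem_setReg, mem_setMem, Exp.eval, h11, e, e0 a (by omega)]
  rintro t₃ s₃ hf₃ ⟨ht₃, -, e0⟩
  simp only [run_block_cons, run_assign, run_block_nil]
  refine ⟨by simp only [Exp.cost]; omega, ?_, ?_, ?_, ?_, ?_⟩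
  · simp [reg_setReg, Exp.eval, hf₃.1 1 (by decide), hf₂.1 1 (by decide), k1]
  · simp [reg_setReg, Exp.eval, hf₃.1 0 (by decide), hf₂.1 0 (by decide), k0]
  · simp [reg_setReg, Exp.eval, hf₃.1 15 (by decide), hf₂.1 15 (by decide), k15]
  · simpa [mem_setReg, hf₃.2 1 (by decide)] using f1
  · intro a ha
    simp only [mem_setReg, e0 a ha, g17 a ha]

/-- Computes the condensed representation of the transpose of `shrink q A L B`. Array `15` holds
`L`, variable `14` holds `B`, and array `16` the density removed in each row. -/
def shrinkProg : Prog :=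
  .block [initTree, loadTop, loadCore, link, sweep, filterCore, addStairs, borders]

/-- The listed cells are those of the new core. -/
theorem mem_cells_iff {p q n : ℕ} {A : ℕ → ℕ → ℤ} {r c L : ℕ → ℕ} {B : ℤ} (hB : 0 < B)
    (h : IsCoreList p q n A r c) (x : ℕ × ℕ) :
    ((∃ m < n, x = (r m, c m) ∧ L (r m + 1) ≤ c m) ∨
      (x.1 + 1 < p ∧ x.2 + 1 < q ∧ L (x.1 + 1) = x.2 + 1)) ↔
    x.1 + 1 < p ∧ x.2 + 1 < q ∧ dens (shrink q A L B) x.1 x.2 ≠ 0 := by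
  constructor
  · rintro (⟨m, hm, rfl, hle⟩ | ⟨h1, h2, h3⟩)
    · obtain ⟨h1, h2, h3⟩ := h.mem m hm
      refine ⟨h1, h2, ?_⟩
      rw [dens_shrink h2, if_neg (by simp only; omega), if_neg (by simp only; omega), add_zero]
      exact h3
    · refine ⟨h1, h2, ?_⟩
      rw [dens_shrink h2, if_pos (by omega), if_pos h3, zero_add]
      exact hB.ne'
  · rintro ⟨h1, h2, h3⟩
    rw [dens_shrink h2] at h3
    by_cases e : L (x.1 + 1) = x.2 + 1
    · exact Or.inr ⟨h1, h2, e⟩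
    · rw [if_neg e, add_zero] at h3
      by_cases e' : x.2 < L (x.1 + 1)
      · exact absurd (if_pos e') h3
      · rw [if_neg e'] at h3
        obtain ⟨m, hm, hr, hc⟩ := h.surj _ _ h1 h2 h3
        exact Or.inl ⟨m, hm, by rw [hr, hc], by rw [hr, hc]; omega⟩

theorem sum_removed {p q n : ℕ} {A : ℕ → ℕ → ℤ} {r c : ℕ → ℕ} (L : ℕ → ℕ)
    (h : IsCoreList p q n A r c) {a : ℕ} (ha : a < p) :
    (∑ a' ∈ Finset.range (a + 1), ∑ m ∈ Finset.range n,
      if r m + 1 = a' ∧ c m < L a' then dens A (r m) (c m) else 0) =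
    ∑ i ∈ Finset.range a, ∑ j ∈ Finset.range (q - 1),
      if j < L (i + 1) then dens A i j else 0 := by
  rw [Finset.sum_range_succ', Finset.sum_eq_zero (s := Finset.range n), add_zero]
  · refine Finset.sum_congr rfl fun i hi => ?_
    rw [Finset.mem_range] at hi
    rw [h.sum_eq (fun i' j => if i' + 1 = i + 1 ∧ j < L (i + 1) then dens A i' j else 0)
      (fun i j h => by simp [h]), Finset.sum_eq_single i]
    · simp
    · intro i' _ hne
      exact Finset.sum_eq_zero fun j _ => if_neg fun h => hne (by omega)
    · intro hn
      rw [Finset.mem_range] at hn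
      omega
  · intro m _
    exact if_neg (by omega)

/-- A list of cells in transposed form yields the core of the transposed matrix. -/
theorem isCoreList_of_cells {p q : ℕ} {A : ℕ → ℕ → ℤ} {l : List (ℕ × ℕ)} (hnd : l.Nodup)
    (hm : ∀ x, x ∈ l ↔ x.1 + 1 < p ∧ x.2 + 1 < q ∧ dens A x.1 x.2 ≠ 0) :
    IsCoreList q p l.length (fun a b => A b a) (fun m => (l.getD m 0).2)
      (fun m => (l.getD m 0).1) := by
  refine ⟨fun m h => ?_, fun m h m' h' e1 e2 => ?_, fun i j h1 h2 h3 => ?_⟩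
  · rw [List.getD_eq_getElem _ _ h, dens_transpose]
    have := (hm _).1 (List.getElem_mem h)
    exact ⟨this.2.1, this.1, this.2.2⟩
  · rw [List.getD_eq_getElem _ _ h, List.getD_eq_getElem _ _ h'] at e1 e2
    exact (hnd.getElem_inj_iff).1 (Prod.ext e2 e1)
  · rw [dens_transpose] at h3
    obtain ⟨m, h, e⟩ := List.mem_iff_getElem.1 ((hm (j, i)).2 ⟨h2, h1, h3⟩)
    refine ⟨m, h, ?_⟩
    rw [List.getD_eq_getElem _ _ h, e]
    exact ⟨rfl, rfl⟩

theorem run_shrinkProg {s : State} {p q k n : ℕ} {A : ℕ → ℕ → ℤ} {r c : ℕ → ℕ}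
    (hi : Input s p q k n A r c) (hp : 0 < p) (hq : 0 < q)
    (hA : ∀ i j, i + 1 < p → j + 1 < q → 0 ≤ dens A i j) :
    Run shrinkProg s fun t s' =>
      (∃ h, 2 ^ h ≤ 2 * q ∧ t ≤ 2000 * ((n + p + q) * (h + 1))) ∧
      ∃ L B n' r' c', Leftmost p q k A L ∧
        k + 1 + ∑ i ∈ Finset.range (p - 1), ∑ j ∈ Finset.range (q - 1), dens A i j = B ∧
        Input s' q p k n' (fun a b => shrink q A L B b a) r' c' := by
  rw [shrinkProg, run_block_cons]
  refine (run_initTree hq hi.cols).mono ?_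
  rintro t₁ s₁ hf₁ ⟨ht₁, h, hqh, hh, htr₁⟩
  have hi₁ := hi.frame hf₁ (by decide) (by decide)
  rw [run_block_cons]
  refine (run_loadTop hi₁ hq hqh htr₁).mono ?_
  rintro t₂ s₂ - ⟨ht₂, hi₂, htr₂⟩
  rw [run_block_cons]
  refine (run_loadCore hi₂ hqh htr₂).mono ?_
  rintro t₃ s₃ - ⟨ht₃, hi₃, htr₃⟩
  rw [run_block_cons]
  refine (run_link hi₃).mono ?_
  rintro t₄ s₄ hf₄ ⟨ht₄, hrow₄, hB₄, h16₄⟩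
  have hi₄ := hi₃.frame hf₄ (by decide) (by decide)
  have htr₄ := htr₃.frame hf₄ (by decide) (by decide) (by decide) (by decide)
  rw [run_block_cons]
  refine (run_sweep hi₄ hqh htr₄ hrow₄).mono ?_
  rintro t₅ s₅ hf₅ ⟨ht₅, L, hL, h15₅⟩
  have hi₅ := hi₄.frame hf₅ (by decide) (by decide)
  have h16₅ : ∀ a < p, s₅.mem 16 (a : ℕ) = 0 := by
    rw [hf₅.2 16 (by decide)]
    exact h16₄
  obtain ⟨B, hB⟩ : ∃ B, s₄.reg 14 = B := ⟨_, rfl⟩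
  have h14₅ : s₅.reg 14 = B := (hf₅.1 14 (by decide)).trans hB
  rw [hB, hi.list.sum_eq (dens A) fun _ _ h => h] at hB₄
  have hBpos : 0 < B := by
    have : 0 ≤ ∑ i ∈ Finset.range (p - 1), ∑ j ∈ Finset.range (q - 1), dens A i j := by
      refine Finset.sum_nonneg fun i hi => Finset.sum_nonneg fun j hj => ?_
      rw [Finset.mem_range] at hi hj
      exact hA i j (by omega) (by omega)
    omega
  rw [run_block_cons]
  refine (run_filterCore (A' := shrink q A L B) hi₅ h15₅ h16₅ ?_).mono ?_
  · intro i j _ h2 h3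
    rw [dens_shrink h2, if_neg (by omega), if_neg (by omega), add_zero]
  rintro t₆ s₆ hf₆ ⟨ht₆, l₀, hl₀, hnd₀, hm₀, h16₆⟩
  have h15₆ : ∀ a < p, s₆.mem 15 (a : ℕ) = L a := by
    rw [hf₆.2 15 (by decide)]
    exact h15₅
  have h14₆ := (hf₆.1 14 (by decide)).trans h14₅
  rw [run_block_cons]
  refine (run_addStairs (A' := shrink q A L B) (l₀ := l₀) (q := q) hp
    ((hf₆.1 0 (by decide)).trans hi₅.rows) ((hf₆.1 1 (by decide)).trans hi₅.cols) h15₆ ?_ hl₀ hnd₀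
    ?_).mono ?_
  · intro i _ h2 h3
    rw [dens_shrink (by omega), if_pos (by omega), if_pos (by omega), zero_add, h14₆]
  · intro x hx
    obtain ⟨m, -, rfl, hle⟩ := (hm₀ x).1 hx
    exact hle
  rintro t₇ s₇ hf₇ ⟨ht₇, l, hl, hnd, hm⟩
  have hmem : ∀ x, x ∈ l ↔ x.1 + 1 < p ∧ x.2 + 1 < q ∧ dens (shrink q A L B) x.1 x.2 ≠ 0 := by
    intro x
    rw [hm, hm₀]
    exact mem_cells_iff hBpos hi.list x
  rw [run_block_cons]
  refine (run_borders (A := A) (L := L) (q := q) (B := B)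
    (D := fun a => ∑ m ∈ Finset.range n,
      if r m + 1 = a ∧ c m < L a then dens A (r m) (c m) else 0) hp
    ((hf₇.1 0 (by decide)).trans <| (hf₆.1 0 (by decide)).trans hi₅.rows)
    ((hf₇.1 1 (by decide)).trans <| (hf₆.1 1 (by decide)).trans hi₅.cols)
    ((hf₇.1 14 (by decide)).trans h14₆) ?_ ?_ ?_ ?_).mono ?_
  · rw [hf₇.2 0 (by decide), hf₆.2 0 (by decide)]
    exact hi₅.top
  · rw [hf₇.2 1 (by decide), hf₆.2 1 (by decide)]
    exact hi₅.left
  · rw [hf₇.2 15 (by decide)]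
    exact h15₆
  · rw [hf₇.2 16 (by decide)]
    exact h16₆
  rintro t₈ s₈ hf₈ ⟨ht₈, g0, g1, g3, gl, gt⟩
  rw [run_block_nil]
  refine ⟨⟨h, hh, ?_⟩, L, B, l.length, _, _, hL, hB₄.symm, g0, g1, ?_, g3.trans hl.1,
    fun a ha => ?_, fun b hb => ?_, fun m hml => ?_, isCoreList_of_cells hnd hmem⟩
  · have e1 : n * (100 * (h + 1)) = 100 * (n * (h + 1)) := by ring
    have e2 : q * (100 * (h + 1)) = 100 * (q * (h + 1)) := by ring
    have e3 : (p + q + n) * (200 * (h + 1))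
      = 200 * (p * (h + 1)) + 200 * (q * (h + 1)) + 200 * (n * (h + 1)) := by ring
    have e4 : (n + p + q) * (h + 1) = n * (h + 1) + p * (h + 1) + q * (h + 1) := by ring
    have e5 : n ≤ n * (h + 1) := Nat.le_mul_of_pos_right _ (by omega)
    have e6 : p ≤ p * (h + 1) := Nat.le_mul_of_pos_right _ (by omega)
    have e7 : q ≤ q * (h + 1) := Nat.le_mul_of_pos_right _ (by omega)
    omega
  · rw [hf₈.1 2 (by decide), hf₇.1 2 (by decide), hf₆.1 2 (by decide), hi₅.thr]
  · rw [gt a ha, sum_removed L hi.list ha, shrink_left]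
  · rw [gl b hb, shrink_top]
  · obtain ⟨c2, c3, c4⟩ := hl.2 m hml
    rw [hf₈.2 2 (by decide), hf₈.2 3 (by decide), hf₈.2 4 (by decide), c2, c3, c4, dens_transpose,
      List.getD_eq_getElem _ _ hml]
    exact ⟨rfl, rfl, rfl⟩

end RAM

/-! ### The size of the final core -/

namespace Monge

theorem dens_shrink_nonneg {p q : ℕ} {A : ℕ → ℕ → ℤ} {L : ℕ → ℕ} {B : ℤ} (hB : 0 ≤ B)
    (hA : ∀ i j, i + 1 < p → j + 1 < q → 0 ≤ dens A i j) (i j : ℕ) (hi : i + 1 < p)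
    (hj : j + 1 < q) : 0 ≤ dens (shrink q A L B) i j := by
  have := hA i j hi hj
  rw [dens_shrink hj]
  split_ifs <;> omega

theorem shrink_kEquiv {p q k : ℕ} {A : ℕ → ℕ → ℤ} {L : ℕ → ℕ} {B : ℤ}
    (hL : Leftmost p q k A L) (hA : ∀ i j, i + 1 < p → j + 1 < q → 0 ≤ dens A i j)
    (hB : k + 1 + ∑ i ∈ Finset.range (p - 1), ∑ j ∈ Finset.range (q - 1), dens A i j ≤ B)
    (h0 : ∀ a b, a < p → b < q → 0 ≤ A a b) {a b : ℕ} (ha : a < p) (hb : b < q) :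
    shrink q A L B a b = A a b ∨ (k < shrink q A L B a b ∧ k < A a b) := by
  by_cases h : b < L a
  · exact Or.inr ⟨lt_shrink hA hB ha h (h0 a b ha hb), hL.lt a ha b h⟩
  · exact Or.inl (shrink_eq B hL ha (by omega))

theorem coreCells_shrink_subset (p q : ℕ) (A : ℕ → ℕ → ℤ) (L : ℕ → ℕ) (B : ℤ) :
    coreCells p q (shrink q A L B) ⊆ ((coreCells p q A).filter fun x => L (x.1 + 1) ≤ x.2) ∪
      (Finset.range p).image fun i => (i, L (i + 1) - 1) := by
  rintro ⟨i, j⟩ hx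
  obtain ⟨h1, h2, h3⟩ := mem_coreCells.1 hx
  simp only at h1 h2 h3
  rw [dens_shrink h2] at h3
  simp only [Finset.mem_union, Finset.mem_filter, mem_coreCells, Finset.mem_image,
    Finset.mem_range, Prod.mk.injEq]
  by_cases e : L (i + 1) = j + 1
  · exact Or.inr ⟨i, by omega, rfl, by omega⟩
  · rw [if_neg e, add_zero] at h3
    by_cases e' : j < L (i + 1)
    · exact absurd (if_pos e') h3
    · rw [if_neg e'] at h3
      exact Or.inl ⟨⟨h1, h2, h3⟩, by omega⟩

theorem card_coreCells_shrink_le (p q : ℕ) (A : ℕ → ℕ → ℤ) (L : ℕ → ℕ) (B : ℤ) :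
    (coreCells p q (shrink q A L B)).card ≤ (coreCells p q A).card + p := by
  have h1 := (Finset.card_le_card (coreCells_shrink_subset p q A L B)).trans
    (Finset.card_union_le _ _)
  have h2 := Finset.card_filter_le (coreCells p q A) fun x => L (x.1 + 1) ≤ x.2
  have h3 := Finset.card_image_le (s := Finset.range p) (f := fun i => (i, L (i + 1) - 1))
  rw [Finset.card_range] at h3
  omega

theorem coreCells_transpose (p q : ℕ) (A : ℕ → ℕ → ℤ) :
    coreCells q p (fun a b => A b a) = (coreCells p q A).image Prod.swap := by
  ext ⟨j, i⟩
  simp only [mem_coreCells, Finset.mem_image, Prod.exists, dens_transpose, Prod.swap_prod_mk,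
    Prod.mk.injEq]
  constructor
  · rintro ⟨h1, h2, h3⟩
    exact ⟨i, j, ⟨h2, h1, h3⟩, rfl, rfl⟩
  · rintro ⟨i, j, ⟨h1, h2, h3⟩, rfl, rfl⟩
    exact ⟨h2, h1, h3⟩

/-- If every cell in `P` has an entry at most `k` both to its lower left and to its upper right,
then the rectangle spanned by two such entries has total density at most `2k`, and it contains
all of `P` between two given elements. -/
theorem card_core_le {p q k : ℕ} (hk : 0 < k) {A : ℕ → ℕ → ℤ} (P : Finset (ℕ × ℕ))
    (hP : P ⊆ coreCells p q A)
    (hA : ∀ i j, i + 1 < p → j + 1 < q → 0 ≤ dens A i j)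
    (h0 : ∀ a b, a < p → b < q → 0 ≤ A a b)
    (hl : ∀ x ∈ P, ∃ a b, x.1 < a ∧ a < p ∧ b ≤ x.2 ∧ A a b ≤ k)
    (hu : ∀ x ∈ P, ∃ a b, a ≤ x.1 ∧ x.2 < b ∧ b < q ∧ A a b ≤ k) :
    (P.card : ℝ) ≤ 15 * √((p : ℝ) * q * (2 * k : ℕ)) := by
  refine card_le_sqrt (by omega) P (fun x hx => ?_) fun x hx y hy => ?_
  · have := mem_coreCells.1 (hP hx)
    omega
  obtain ⟨a', b', h1, h2, h3, h4⟩ := hu x hx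
  obtain ⟨a, b, h5, h6, h7, h8⟩ := hl y hy
  set Z := P.filter fun z => x.1 ≤ z.1 ∧ z.1 ≤ y.1 ∧ y.2 ≤ z.2 ∧ z.2 ≤ x.2 with hZ
  rcases Z.eq_empty_or_nonempty with he | ⟨z₀, hz₀⟩
  · simp [he]
  rw [hZ, Finset.mem_filter] at hz₀
  have hsub : Z ⊆ Finset.Ico a' a ×ˢ Finset.Ico b b' := by
    intro z hz
    rw [hZ, Finset.mem_filter] at hz
    rw [Finset.mem_product, Finset.mem_Ico, Finset.mem_Ico]
    omega
  have hsum : (Z.card : ℤ) ≤ ∑ z ∈ Finset.Ico a' a ×ˢ Finset.Ico b b', dens A z.1 z.2 := by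
    refine le_trans ?_ (Finset.sum_le_sum_of_subset_of_nonneg hsub fun z hz _ => ?_)
    · rw [← nsmul_one, ← Finset.sum_const]
      refine Finset.sum_le_sum fun z hz => ?_
      obtain ⟨g1, g2, g3⟩ := mem_coreCells.1 (hP (Finset.mem_filter.1 hz).1)
      have := hA _ _ g1 g2
      omega
    · rw [Finset.mem_product, Finset.mem_Ico, Finset.mem_Ico] at hz
      exact hA _ _ (by omega) (by omega)
  rw [Finset.sum_product', sum_dens A (by omega) (by omega)] at hsum
  have n1 := h0 a' b (by omega) (by omega)
  have n2 := h0 a b' (by omega) (by omega)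
  omega

/-- Shrinking on both sides leaves, apart from at most one new cell per row and column, only
cells that have small entries both to their lower left and to their upper right. -/
theorem card_coreCells_shrink_shrink_le {p q k : ℕ} (hk : 0 < k) {A : ℕ → ℕ → ℤ}
    {L₁ L₂ : ℕ → ℕ} {B₁ B₂ : ℤ}
    (hA : ∀ i j, i + 1 < p → j + 1 < q → 0 ≤ dens A i j)
    (h0 : ∀ a b, a < p → b < q → 0 ≤ A a b)
    (hB₁ : k + 1 + ∑ i ∈ Finset.range (p - 1), ∑ j ∈ Finset.range (q - 1), dens A i j ≤ B₁)
    (hL₁ : Leftmost p q k A L₁) (hL₂ : Leftmost q p k (fun b a => shrink q A L₁ B₁ a b) L₂) :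
    ((coreCells q p (shrink p (fun b a => shrink q A L₁ B₁ a b) L₂ B₂)).card : ℝ)
      ≤ 15 * √((p : ℝ) * q * (2 * k : ℕ)) + p + q := by
  set P := (coreCells p q A).filter fun x => L₁ (x.1 + 1) ≤ x.2 ∧ L₂ (x.2 + 1) ≤ x.1 with hPdef
  have hsub : coreCells q p (shrink p (fun b a => shrink q A L₁ B₁ a b) L₂ B₂) ⊆
      P.image Prod.swap ∪ ((Finset.range p).image (fun i => (L₁ (i + 1) - 1, i)) ∪
        (Finset.range q).image (fun j => (j, L₂ (j + 1) - 1))) := by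
    intro x hx
    rcases Finset.mem_union.1 (coreCells_shrink_subset _ _ _ _ _ hx) with h | h
    · obtain ⟨h1, h2⟩ := Finset.mem_filter.1 h
      rw [coreCells_transpose p q (shrink q A L₁ B₁)] at h1
      obtain ⟨⟨i, j⟩, h3, rfl⟩ := Finset.mem_image.1 h1
      rcases Finset.mem_union.1 (coreCells_shrink_subset _ _ _ _ _ h3) with h | h
      · refine Finset.mem_union_left _ (Finset.mem_image_of_mem _ ?_)
        rw [hPdef, Finset.mem_filter]
        rw [Finset.mem_filter] at h
        exact ⟨h.1, h.2, h2⟩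
      · refine Finset.mem_union_right _ (Finset.mem_union_left _ ?_)
        obtain ⟨i', hi', he⟩ := Finset.mem_image.1 h
        exact Finset.mem_image.2 ⟨i', hi', by rw [← he]; rfl⟩
    · exact Finset.mem_union_right _ (Finset.mem_union_right _ h)
  have hcard : (coreCells q p (shrink p (fun b a => shrink q A L₁ B₁ a b) L₂ B₂)).card
      ≤ P.card + p + q := by
    have h1 := (Finset.card_le_card hsub).trans (Finset.card_union_le _ _)
    have h2 := Finset.card_union_le ((Finset.range p).image (fun i => (L₁ (i + 1) - 1, i)))
      ((Finset.range q).image (fun j => (j, L₂ (j + 1) - 1)))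
    have h3 := Finset.card_image_le (s := P) (f := Prod.swap)
    have h4 := Finset.card_image_le (s := Finset.range p) (f := fun i => (L₁ (i + 1) - 1, i))
    have h5 := Finset.card_image_le (s := Finset.range q) (f := fun j => (j, L₂ (j + 1) - 1))
    rw [Finset.card_range] at h4 h5
    omega
  have hP := card_core_le hk P (Finset.filter_subset _ _) hA h0 (fun x hx => ?_) fun x hx => ?_
  · have : ((coreCells q p (shrink p (fun b a => shrink q A L₁ B₁ a b) L₂ B₂)).card : ℝ)
        ≤ P.card + p + q := by exact_mod_cast hcard
    linarith
  · obtain ⟨hc, hx1, -⟩ := Finset.mem_filter.1 hx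
    obtain ⟨g1, g2, -⟩ := mem_coreCells.1 hc
    obtain ⟨a, b, w1, w2, w3, w4⟩ := hL₁.wit _ g1 _ (by omega) hx1
    exact ⟨a, b, w1, w2, w3, w4⟩
  · obtain ⟨hc, -, hx2⟩ := Finset.mem_filter.1 hx
    obtain ⟨g1, g2, -⟩ := mem_coreCells.1 hc
    obtain ⟨b, a, w1, w2, w3, w4⟩ := hL₂.wit _ g2 _ (by omega) hx2
    refine ⟨a, b, w3, w1, w2, ?_⟩
    rcases shrink_kEquiv hL₁ hA hB₁ h0 (a := a) (b := b) (by omega) w2 with h | h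
    · rwa [← h]
    · omega

/-! ### Matrices and functions on index pairs -/

/-- The entries of a matrix, extended by `0` to all index pairs. -/
def entry {p q : ℕ} (C : Matrix (Fin p) (Fin q) ℤ) (a b : ℕ) : ℤ :=
  if h : a < p ∧ b < q then C ⟨a, h.1⟩ ⟨b, h.2⟩ else 0

theorem entry_of_lt {p q : ℕ} (C : Matrix (Fin p) (Fin q) ℤ) {a b : ℕ} (ha : a < p) (hb : b < q) :
    entry C a b = C ⟨a, ha⟩ ⟨b, hb⟩ := dif_pos ⟨ha, hb⟩

theorem density_eq {p q : ℕ} {C : Matrix (Fin p) (Fin q) ℤ} {A : ℕ → ℕ → ℤ}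
    (h : ∀ i j, C i j = A i j) (i : Fin (p - 1)) (j : Fin (q - 1)) :
    density C i j = dens A i j := by
  simp only [density, dens, h]

theorem eq_entry {p q : ℕ} (C : Matrix (Fin p) (Fin q) ℤ) (i : Fin p) (j : Fin q) :
    C i j = entry C i j := (entry_of_lt C i.2 j.2).symm

theorem mem_core {p q : ℕ} {C : Matrix (Fin p) (Fin q) ℤ} {A : ℕ → ℕ → ℤ}
    (h : ∀ i j, C i j = A i j) (x : Fin (p - 1) × Fin (q - 1) × ℤ) :
    x ∈ core C ↔ x.2.2 = dens A x.1 x.2.1 ∧ dens A x.1 x.2.1 ≠ 0 := by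
  obtain ⟨i, j, v⟩ := x
  simp only [core, Finset.mem_image, Finset.mem_filter, Finset.mem_univ, true_and, density_eq h,
    Prod.mk.injEq, Prod.exists]
  constructor
  · rintro ⟨i, j, h1, rfl, rfl, rfl⟩
    exact ⟨rfl, h1⟩
  · rintro ⟨rfl, h2⟩
    exact ⟨i, j, h2, rfl, rfl, rfl⟩

theorem coreSize_eq {p q : ℕ} {C : Matrix (Fin p) (Fin q) ℤ} {A : ℕ → ℕ → ℤ}
    (h : ∀ i j, C i j = A i j) : coreSize C = (coreCells p q A).card := by
  refine Finset.card_bij (fun x _ => ((x.1 : ℕ), (x.2.1 : ℕ))) (fun x hx => ?_)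
    (fun x hx y hy e => ?_) fun x hx => ?_
  · rw [mem_core h] at hx
    exact mem_coreCells.2 ⟨by have := x.1.2; simp only; omega, by have := x.2.1.2; simp only; omega,
      hx.2⟩
  · rw [mem_core h] at hx hy
    obtain ⟨i, j, v⟩ := x
    obtain ⟨i', j', v'⟩ := y
    simp only [Prod.mk.injEq] at e hx hy ⊢
    obtain ⟨e1, e2⟩ := e
    exact ⟨Fin.ext e1, Fin.ext e2, by rw [hx.1, hy.1, e1, e2]⟩
  · obtain ⟨h1, h2, h3⟩ := mem_coreCells.1 hx
    exact ⟨(⟨x.1, by omega⟩, ⟨x.2, by omega⟩, dens A x.1 x.2), (mem_core h _).2 ⟨rfl, h3⟩, rfl⟩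

theorem isMonge_iff {p q : ℕ} {C : Matrix (Fin p) (Fin q) ℤ} {A : ℕ → ℕ → ℤ}
    (h : ∀ i j, C i j = A i j) :
    IsMonge C ↔ ∀ i j, i + 1 < p → j + 1 < q → 0 ≤ dens A i j := by
  constructor
  · intro hC i j hi hj
    have := hC ⟨i, by omega⟩ ⟨j, by omega⟩
    simp only [h] at this
    unfold dens
    omega
  · intro hA i j
    have := hA i j (by omega) (by omega)
    unfold dens at this
    simp only [h]
    omega

end Monge

namespace RAM

open Monge

theorem StoresCondensed.exists_input {s : State} {p q k : ℕ} {C : Matrix (Fin p) (Fin q) ℤ}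
    (h : StoresCondensed s C) (hp : 0 < p) (hq : 0 < q) (hk : s.reg 2 = k) :
    ∃ r c, Input s p q k (coreSize C) (entry C) r c := by
  obtain ⟨h0, h1, ht, hl, h3, e, he⟩ := h
  refine ⟨fun m => if h : m < coreSize C then (e ⟨m, h⟩).1.1 else 0,
    fun m => if h : m < coreSize C then (e ⟨m, h⟩).1.2.1 else 0, h0, h1, hk, h3, fun b hb => ?_,
    fun a ha => ?_, fun m hm => ?_, fun m hm => ?_, fun m hm m' hm' e1 e2 => ?_,
    fun i j hi hj hd => ?_⟩
  · rw [entry_of_lt C hp hb]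
    exact ht ⟨0, hp⟩ ⟨b, hb⟩ rfl
  · rw [entry_of_lt C ha hq]
    exact hl ⟨a, ha⟩ ⟨0, hq⟩ rfl
  · obtain ⟨c2, c3, c4⟩ := he ⟨m, hm⟩
    simp only [hm, dif_pos]
    exact ⟨c2, c3, c4.trans ((mem_core (eq_entry C) _).1 (e ⟨m, hm⟩).2).1⟩
  · simp only [hm, dif_pos]
    exact ⟨by have := (e ⟨m, hm⟩).1.1.2; omega, by have := (e ⟨m, hm⟩).1.2.1.2; omega,
      ((mem_core (eq_entry C) _).1 (e ⟨m, hm⟩).2).2⟩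
  · simp only [hm, hm', dif_pos] at e1 e2
    have g1 := ((mem_core (eq_entry C) _).1 (e ⟨m, hm⟩).2).1
    have g2 := ((mem_core (eq_entry C) _).1 (e ⟨m', hm'⟩).2).1
    have : e ⟨m, hm⟩ = e ⟨m', hm'⟩ :=
      Subtype.ext (Prod.ext (Fin.ext e1) (Prod.ext (Fin.ext e2) (by rw [g1, g2, e1, e2])))
    simpa using e.injective this
  · obtain ⟨⟨m, hm⟩, he'⟩ := e.surjective ⟨(⟨i, by omega⟩, ⟨j, by omega⟩, dens (entry C) i j),
      (mem_core (eq_entry C) _).2 ⟨rfl, hd⟩⟩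
    exact ⟨m, hm, by simp [hm, he'], by simp [hm, he']⟩

theorem Input.storesCondensed {s : State} {p q k n : ℕ} {A : ℕ → ℕ → ℤ} {r c : ℕ → ℕ}
    (h : Input s p q k n A r c) {C : Matrix (Fin p) (Fin q) ℤ} (hC : ∀ i j, C i j = A i j) :
    StoresCondensed s C := by
  have hn : n = coreSize C := by rw [coreSize_eq hC, h.list.card_eq]
  subst hn
  have hmem := h.list.mem
  let f : Fin (coreSize C) → {x // x ∈ Monge.core C} := fun m =>
    ⟨(⟨r m, by have := hmem m m.2; omega⟩, ⟨c m, by have := hmem m m.2; omega⟩,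
      dens A (r m) (c m)), (mem_core hC _).2 ⟨rfl, (hmem m m.2).2.2⟩⟩
  have hf : Function.Bijective f := by
    constructor
    · intro m m' e
      simp only [f, Subtype.mk.injEq, Prod.mk.injEq, Fin.mk.injEq] at e
      exact Fin.ext (h.list.inj m m.2 m' m'.2 e.1 e.2.1)
    · rintro ⟨⟨i, j, v⟩, hx⟩
      obtain ⟨hv, hd⟩ := (mem_core hC _).1 hx
      simp only at hv hd
      obtain ⟨m, hm, h1, h2⟩ := h.list.surj i j (by omega) (by omega) hd
      refine ⟨⟨m, hm⟩, Subtype.ext (Prod.ext (Fin.ext h1) (Prod.ext (Fin.ext h2) ?_))⟩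
      simp only [f, h1, h2, hv]
  refine ⟨h.rows, h.cols, fun i j hi => ?_, fun i j hj => ?_, h.num, Equiv.ofBijective f hf,
    fun m => h.core m m.2⟩
  · rw [h.top j j.2, hC, hi]
  · rw [h.left i i.2, hC, hj]

/-- The number of levels of a tree with `2 ^ h ≤ 2q` leaves is logarithmic in `N`. -/
theorem height_le {h q N : ℕ} (hN : 2 ≤ N) (hq : q ≤ N) (hh : 2 ^ h ≤ 2 * q) :
    ((h + 1 : ℕ) : ℝ) ≤ 6 * Real.log N := by
  have h2 : (0.5 : ℝ) ≤ Real.log 2 := by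
    have := Real.log_two_gt_d9
    linarith
  have hlog : Real.log 2 ≤ Real.log N :=
    Real.log_le_log (by norm_num) (by exact_mod_cast hN)
  have h3 : (2 : ℝ) ^ h ≤ 2 * N := by exact_mod_cast hh.trans (Nat.mul_le_mul_left 2 hq)
  have h4 := Real.log_le_log (by positivity) h3
  rw [Real.log_pow, Real.log_mul (by norm_num) (by positivity)] at h4
  push_cast
  nlinarith [Nat.cast_nonneg (α := ℝ) h]

end RAM

/-! ### Shrinking on both sides -/

namespace RAM

open Monge

/-- Running `shrinkProg` twice handles the lower left and the upper right side, and restores the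
orientation of the matrix. -/
theorem run_shrinkProg_twice {N p q k : ℕ} (hN : 2 ≤ N) (hp : 0 < p) (hpN : p ≤ N) (hq : 0 < q)
    (hqN : q ≤ N) (hk : 0 < k) {C : Matrix (Fin p) (Fin q) ℤ} (hC : IsMonge C)
    (h0 : ∀ i j, 0 ≤ C i j) {s : State} (hs : StoresCondensed s C) (h2 : s.reg 2 = k) :
    ∃ (t : ℕ) (s' : State) (C' : Matrix (Fin p) (Fin q) ℤ),
      Exec (.seq shrinkProg shrinkProg) s t s' ∧
      (t : ℝ) ≤ 60000 * (((coreSize C : ℝ) + N) * Real.log N) ∧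
      StoresCondensed s' C' ∧ IsMonge C' ∧ (∀ i j, 0 ≤ C' i j) ∧
      (coreSize C' : ℝ) ≤ 32 * (N * √(k : ℝ)) ∧ KEquiv k C' C := by
  obtain ⟨r, c, hin⟩ := hs.exists_input hp hq h2
  set n := coreSize C with hn
  set A := entry C with hAdef
  have hA := (isMonge_iff (eq_entry C)).1 hC
  have hA0 : ∀ a b, a < p → b < q → 0 ≤ A a b := by
    intro a b ha hb
    rw [hAdef, entry_of_lt C ha hb]
    exact h0 _ _
  obtain ⟨t₁, s₁, he₁, ⟨ℓ₁, hℓ₁, ht₁⟩, L₁, B₁, n₁, r₁, c₁, hL₁, hB₁, hin₁⟩ :=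
    run_shrinkProg hin hp hq hA
  have sum_nonneg : ∀ (p q : ℕ) (A : ℕ → ℕ → ℤ),
      (∀ i j, i + 1 < p → j + 1 < q → 0 ≤ dens A i j) →
      0 ≤ ∑ i ∈ Finset.range (p - 1), ∑ j ∈ Finset.range (q - 1), dens A i j := by
    intro p q A hA
    refine Finset.sum_nonneg fun i hi => Finset.sum_nonneg fun j hj => ?_
    rw [Finset.mem_range] at hi hj
    exact hA i j (by omega) (by omega)
  have hA₁ := dens_shrink_nonneg (L := L₁) (B := B₁) (by have := sum_nonneg p q A hA; omega) hA
  have hE₁ := fun a b ha hb =>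
    shrink_kEquiv hL₁ hA hB₁.le hA0 (a := a) (b := b) ha hb
  set A₁ : ℕ → ℕ → ℤ := fun b a => shrink q A L₁ B₁ a b with hA₁def
  have hT : ∀ i j, i + 1 < q → j + 1 < p → 0 ≤ dens A₁ i j := by
    intro i j hi hj
    rw [hA₁def, dens_transpose]
    exact hA₁ j i hj hi
  have hT0 : ∀ b a, b < q → a < p → 0 ≤ A₁ b a := by
    intro b a hb ha
    rcases hE₁ a b ha hb with h | h
    · rw [hA₁def]
      simp only [h]
      exact hA0 a b ha hb
    · exact le_trans (Nat.cast_nonneg k) h.1.le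
  obtain ⟨t₂, s₂, he₂, ⟨ℓ₂, hℓ₂, ht₂⟩, L₂, B₂, n₂, r₂, c₂, hL₂, hB₂, hin₂⟩ :=
    run_shrinkProg hin₁ hq hp hT
  have hA₂ := dens_shrink_nonneg (L := L₂) (B := B₂) (by have := sum_nonneg q p A₁ hT; omega) hT
  have hE₂ := fun b a hb ha =>
    shrink_kEquiv hL₂ hT hB₂.le hT0 (a := b) (b := a) hb ha
  set C' : Matrix (Fin p) (Fin q) ℤ := Matrix.of fun i j => shrink p A₁ L₂ B₂ j i with hC'def
  have hC' : ∀ i j, C' i j = (fun a b => shrink p A₁ L₂ B₂ b a) i j := fun _ _ => rfl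
  refine ⟨t₁ + t₂, s₂, C', .seq he₁ he₂, ?_, hin₂.storesCondensed hC', (isMonge_iff
    (A := fun a b => shrink p A₁ L₂ B₂ b a) hC').2 ?_,
    fun i j => ?_, ?_, fun i j => ?_⟩
  · have hn₁ : n₁ ≤ n + p := by
      rw [← hin₁.list.card_eq, hA₁def, coreCells_transpose p q (shrink q A L₁ B₁)]
      refine Finset.card_image_le.trans ((card_coreCells_shrink_le _ _ _ _ _).trans ?_)
      rw [hin.list.card_eq]
    have b₁ := height_le hN hqN hℓ₁
    have b₂ := height_le hN hpN hℓ₂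
    have hlog : 0 ≤ Real.log N := Real.log_nonneg (by exact_mod_cast (by omega : 1 ≤ N))
    have k₁ : (t₁ : ℝ) ≤ 2000 * (((n + p + q : ℕ) : ℝ) * ((ℓ₁ + 1 : ℕ) : ℝ)) := by
      exact_mod_cast ht₁
    have k₂ : (t₂ : ℝ) ≤ 2000 * (((n₁ + q + p : ℕ) : ℝ) * ((ℓ₂ + 1 : ℕ) : ℝ)) := by
      exact_mod_cast ht₂
    have m₁ : ((n + p + q : ℕ) : ℝ) ≤ n + 2 * N := by
      have : n + p + q ≤ n + 2 * N := by omega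
      exact_mod_cast this
    have m₂ : ((n₁ + q + p : ℕ) : ℝ) ≤ n + 3 * N := by
      have : n₁ + q + p ≤ n + 3 * N := by omega
      exact_mod_cast this
    have p₁ := mul_le_mul m₁ b₁ (Nat.cast_nonneg _) (by positivity)
    have p₂ := mul_le_mul m₂ b₂ (Nat.cast_nonneg _) (by positivity)
    have hnl : 0 ≤ (n : ℝ) * Real.log N := mul_nonneg (Nat.cast_nonneg _) hlog
    push_cast
    linarith
  · intro i j hi hj
    rw [dens_transpose]
    exact hA₂ j i hj hi
  · rcases hE₂ j i j.2 i.2 with h | h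
    · rw [hC']
      simp only [h]
      exact hT0 _ _ j.2 i.2
    · exact le_trans (Nat.cast_nonneg k) h.1.le
  · rw [coreSize_eq (A := fun a b => shrink p A₁ L₂ B₂ b a) hC',
      coreCells_transpose q p (shrink p A₁ L₂ B₂),
      Finset.card_image_of_injective _ Prod.swap_injective]
    refine (card_coreCells_shrink_shrink_le hk hA hA0 hB₁.le hL₁ hL₂).trans ?_
    have hNR : (0 : ℝ) ≤ N := Nat.cast_nonneg N
    have hpR : (p : ℝ) ≤ N := by exact_mod_cast hpN
    have hqR : (q : ℝ) ≤ N := by exact_mod_cast hqN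
    have hk1 : (1 : ℝ) ≤ √(k : ℝ) := Real.one_le_sqrt.2 (by exact_mod_cast hk)
    have hs : √((p : ℝ) * q * (2 * k : ℕ)) ≤ 2 * (N * √(k : ℝ)) := by
      have hpq : (p : ℝ) * q ≤ N * N := mul_le_mul hpR hqR (Nat.cast_nonneg _) hNR
      refine Real.sqrt_le_iff.2 ⟨by positivity, ?_⟩
      have hsq : (√(k : ℝ)) ^ 2 = k := Real.sq_sqrt (Nat.cast_nonneg k)
      have hkR : (0 : ℝ) ≤ k := Nat.cast_nonneg k
      rw [mul_pow, mul_pow, hsq]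
      push_cast
      have h1 := mul_le_mul_of_nonneg_right hpq hkR
      have h2 : 0 ≤ (N : ℝ) * N * k := by positivity
      linarith
    have hN1 : (N : ℝ) ≤ N * √(k : ℝ) := le_mul_of_one_le_right hNR hk1
    linarith
  · rw [lt_min_iff, hC', eq_entry C]
    rcases hE₂ j i j.2 i.2 with h | h <;> rcases hE₁ i j i.2 j.2 with h' | h'
    · exact Or.inl (h.trans h')
    · exact Or.inr ⟨by simp only [h]; exact h'.1, h'.2⟩
    · exact Or.inr ⟨h.1, by rw [← hAdef, ← h']; exact h.2⟩
    · exact Or.inr ⟨h.1, h'.2⟩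

end RAM

theorem mainTheorem8 :
    (∃ (prog : RAM.Prog) (c₁ c₂ : ℝ),
      ∀ (N p q k : ℕ), 2 ≤ N → 0 < p → p ≤ N → 0 < q → q ≤ N → 0 < k →
      ∀ C : Matrix (Fin p) (Fin q) ℤ, Monge.IsMonge C → (∀ i j, 0 ≤ C i j) →
      ∀ s : RAM.State, RAM.StoresCondensed s C → s.reg 2 = k →
      ∃ (t : ℕ) (s' : RAM.State) (C' : Matrix (Fin p) (Fin q) ℤ),
        RAM.Exec prog s t s' ∧
        (t : ℝ) ≤ c₁ * (((Monge.coreSize C : ℝ) + N) * Real.log N) ∧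
        RAM.StoresCondensed s' C' ∧
        Monge.IsMonge C' ∧
        (∀ i j, 0 ≤ C' i j) ∧
        (Monge.coreSize C' : ℝ) ≤ c₂ * (N * √(k : ℝ)) ∧
        Monge.KEquiv k C' C) ∧
    (∃ c : ℝ, ∀ (p q s : ℕ), 0 < p → 0 < q → 0 < s →
      ∀ P : Finset (Fin p × Fin q),
        (∀ x ∈ P, (P.filter fun y => y ≠ x ∧ x.1 ≤ y.1 ∧ y.2 ≤ x.2).card ≤ s) →
        (P.card : ℝ) ≤ c * √((p : ℝ) * q * s)) := by
  refine ⟨⟨.seq RAM.shrinkProg RAM.shrinkProg, 60000, 32, ?_⟩, 30, ?_⟩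
  · intro N p q k hN hp hpN hq hqN hk C hC h0 s hs h2
    exact RAM.run_shrinkProg_twice hN hp hpN hq hqN hk hC h0 hs h2
  · intro p q s _ _ hs P hP
    exact Monge.card_le_of_lower_left hs P hP
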